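/- Let $D\in\mathbb N$, let $F:\mathbb R^D\to\mathbb R^D$ and $L:\mathbb R^D\to\mathbb R$ be $C^\infty$, let $t_S<t_E$, and let $y:[t_S,t_E]\to\mathbb R^D$ solve $y'=F(y)$. A comma in an index list denotes partial derivatives, and repeated indices are summed. For $t\in[t_S,t_E]$ let $\Phi_t$ map $x$ to the value at time $t_E$ of the solution of $z'=F(z)$ with $z(t)=x$, and let $\mathcal L_t=L\circ\Phi_t$. Consider on $[t_S,t_E]$ the equations $$\sigma_i'=-\sigma_kF_{k,i}(y),\qquad h_{ij}'=-h_{mj}F_{m,i}(y)-h_{im}F_{m,j}(y)-\sigma_mF_{m,ij}(y),$$ with terminal values $\sigma(t_E)=\nabla L(y(t_E))$ and $h(t_E)=\nabla^2L(y(t_E))$, and the truncated equation, without the last term (to which Eq. (9) of Liu et al. reduces for an end-state loss and no trainable parameters), $$k_{ij}'=-k_{mj}F_{m,i}(y)-k_{im}F_{m,j}(y),\qquad k(t_E)=\nabla^2L(y(t_E)).$$ 1. **Backward system.** A solution $(\sigma,h)$ exists on $[t_S,t_E]$. For every $t\in[t_S,t_E]$, $\Phi_t$ is well defined in a neighbourhood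 of $y(t)$, $\mathcal L_t$ is $C^2$ at $y(t)$, and every solution $(\sigma,h)$ satisfies $\nabla\mathcal L_t(y(t))=\sigma(t)$ and $\nabla^2\mathcal L_t(y(t))=h(t)$. In particular, $\sigma(t_S)$ and $h(t_S)$ are the gradient and the Hessian of $y_S\mapsto L(\Phi_{t_S}(y_S))$ at $y_S=y(t_S)$. 2. **The term is necessary.** A solution $k$ of the truncated equation exists, and $k(t)=\nabla^2\mathcal L_t(y(t))$ holds for all $t\in[t_S,t_E]$ if and only if $\sigma_m(t)F_{m,ij}(y(t))=0$ for all $t\in[t_S,t_E]$ and all $i,j$ ("the term vanishes along $y$"). 3. **Cases in which it vanishes.** If $F$ is linear up to a constant, $F(y)=Ay+c$, then the term vanishes along $y$. If $\nabla L(y(t_E))=0$, then $\sigma\equiv0$ on $[t_S,t_E]$ and the term vanishes along $y$. 4. **Only these cases ensure that it vanishes.** (a) For given $F$ and $y$ there is a linear subspace $W\subseteq\mathbb R^D$ such that, for every smooth $L$, the term vanishes along $y$ if and only if $\nabla L(y(t_E))\in W$. Moreover, $W=\mathbb R^D$ if and only if $F_{m,ij}(y(t))=0$ for all $t\in[t_S,t_E]$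 and all $m,i,j$. (b) If a smooth $F$ is not of the form $F(y)=Ay+c$, then there are $t_S<t_E$, a solution $y$ of $y'=F(y)$ on $[t_S,t_E]$ and a smooth $L$ such that the term does not vanish along $y$ and $k(t_S)\ne\nabla^2\mathcal L_{t_S}(y(t_S))$. (c) If $L$ is smooth and $\nabla L(y_E)\neq0$, then for all $t_S<t_E$ there are a smooth $F$ and a solution $y$ of $y'=F(y)$ on $[t_S,t_E]$ with $y(t_E)=y_E$ such that the term does not vanish along $y$ and $k(t_S)\ne\nabla^2\mathcal L_{t_S}(y(t_S))$. -/

import Mathlib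

open Set Filter Topology
open scoped ContDiff

/-- The state space `ℝ^D`. -/
abbrev State (D : ℕ) : Type := EuclideanSpace ℝ (Fin D)

/-- The partial derivative `∂f/∂y_i` at `x`. -/
noncomputable def partialDeriv {D : ℕ} (i : Fin D) (f : State D → ℝ) (x : State D) : ℝ :=
  fderiv ℝ f x (EuclideanSpace.single i 1)

/-- The vector of first partial derivatives, `f_{,i}`. -/
noncomputable def grad {D : ℕ} (f : State D → ℝ) (x : State D) : Fin D → ℝ :=
  fun i => partialDeriv i f x

/-- The matrix of second partial derivatives, `f_{,ij}`. -/
noncomputable def hess {D : ℕ} (f : State D → ℝ) (x : State D) : Matrix (Fin D) (Fin D) ℝ :=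
  Matrix.of fun i j => partialDeriv j (partialDeriv i f) x

/-- `F_{m,i}(x)`. -/
noncomputable def jac {D : ℕ} (F : State D → State D) (x : State D) (m i : Fin D) : ℝ :=
  grad (fun z => F z m) x i

/-- `F_{m,ij}(x)`. -/
noncomputable def jac2 {D : ℕ} (F : State D → State D) (x : State D) (m i j : Fin D) : ℝ :=
  hess (fun z => F z m) x i j

/-- `y` solves `y' = F(y)` on `[a, b]` (with one-sided derivatives at the end points). -/
def IsTrajectory {D : ℕ} (F : State D → State D) (a b : ℝ) (y : ℝ → State D) : Prop :=
  ∀ t ∈ Icc a b, HasDerivWithinAt y (F (y t)) (Icc a b) t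

open Classical in
/-- The flow of `y' = F(y)` from time `a` to time `b`: the value at `b` of the solution that
starts at `x` at time `a`, and `0` if there is no such solution on `[a, b]`. -/
noncomputable def flowMap {D : ℕ} (F : State D → State D) (a b : ℝ) (x : State D) : State D :=
  if hx : ∃ y : ℝ → State D, IsTrajectory F a b y ∧ y a = x then hx.choose b else 0

/-- The loss of the end state at time `b`, as a function of the state at time `t`. -/
noncomputable def lossFrom {D : ℕ} (F : State D → State D) (L : State D → ℝ) (t b : ℝ) :
    State D → ℝ :=
  fun x => L (flowMap F t b x)

/-- The term `σ_m(t) F_{m,ij}(y(t))`. -/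
noncomputable def curvatureTerm {D : ℕ} (F : State D → State D) (y : ℝ → State D)
    (σ : ℝ → Fin D → ℝ) (t : ℝ) (i j : Fin D) : ℝ :=
  ∑ m, σ t m * jac2 F (y t) m i j

/-- The term `σ_m F_{m,ij}` is zero at all times in `[a, b]`. -/
def CurvatureTermVanishes {D : ℕ} (F : State D → State D) (a b : ℝ) (y : ℝ → State D)
    (σ : ℝ → Fin D → ℝ) : Prop :=
  ∀ t ∈ Icc a b, ∀ i j, curvatureTerm F y σ t i j = 0

/-- `σ` solves `σ_i' = -σ_k F_{k,i}(y)` on `[a, b]` with terminal value `σ(b) = ∇L(y(b))`. -/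
def IsCostate {D : ℕ} (F : State D → State D) (L : State D → ℝ) (a b : ℝ) (y : ℝ → State D)
    (σ : ℝ → Fin D → ℝ) : Prop :=
  σ b = grad L (y b) ∧
  ∀ t ∈ Icc a b, ∀ i,
    HasDerivWithinAt (fun s => σ s i) (-∑ k, σ t k * jac F (y t) k i) (Icc a b) t

/-- `h` solves `h_ij' = -h_mj F_{m,i} - h_im F_{m,j} - σ_m F_{m,ij}` on `[a, b]` along `y`, with
terminal value `h(b) = ∇²L(y(b))`. -/
def IsBackwardHessian {D : ℕ} (F : State D → State D) (L : State D → ℝ) (a b : ℝ)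
    (y : ℝ → State D) (σ : ℝ → Fin D → ℝ) (h : ℝ → Matrix (Fin D) (Fin D) ℝ) : Prop :=
  h b = hess L (y b) ∧
  ∀ t ∈ Icc a b, ∀ i j,
    HasDerivWithinAt (fun s => h s i j)
      (-(∑ m, h t m j * jac F (y t) m i) - (∑ m, h t i m * jac F (y t) m j)
        - curvatureTerm F y σ t i j) (Icc a b) t

/-- `k` solves the equation without the curvature term,
`k_ij' = -k_mj F_{m,i} - k_im F_{m,j}` on `[a, b]` along `y`, with `k(b) = ∇²L(y(b))`. -/
def IsTruncatedHessian {D : ℕ} (F : State D → State D) (L : State D → ℝ) (a b : ℝ)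
    (y : ℝ → State D) (k : ℝ → Matrix (Fin D) (Fin D) ℝ) : Prop :=
  k b = hess L (y b) ∧
  ∀ t ∈ Icc a b, ∀ i j,
    HasDerivWithinAt (fun s => k s i j)
      (-(∑ m, k t m j * jac F (y t) m i) - (∑ m, k t i m * jac F (y t) m j)) (Icc a b) t

/-- `F` is linear in `y`, up to a constant: `F(y) = A y + c`. -/
def IsAffineField {D : ℕ} (F : State D → State D) : Prop :=
  ∃ (A : State D →ₗ[ℝ] State D) (c : State D), ∀ x, F x = A x + c

/-!
The solution of `z' = F(z)` on `[a, b]` with `z(a) = x` is the preimage of the constant `x` under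
the Picard defect `z ↦ (t ↦ z t - ∫ s in a..t, F (z s))`. The derivative of the defect is the
identity minus a Volterra operator, whose powers decay factorially, so it is invertible on the whole
interval, and the inverse function theorem yields an end map `Φ_t` that is as smooth as `F`, with
derivative given by the variational equation.

Along a trajectory, the pairing of an adjoint solution `p` with a solution `w` of the variational
equation is constant; hence `σ(t) = ∇L ∘ DΦ_t`. The statement about Hessians is the same statement
for the prolonged field `(x, v) ↦ (F x, DF(x) v)` and the loss `(x, v) ↦ DL(x) v`: along `(y, w)`
its adjoint solution is `(h(w, ·), σ)`, and the term `σ_m F_{m,ij}` comes from the derivative of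
`DF(x) v` in `x`.

The truncated equation thus differs from the correct one by exactly this term. As
`σ(t) = ∇L ∘ DΦ_t` is linear in the terminal gradient and `DΦ_t` is invertible, the term vanishes
for a linear subspace of terminal gradients, and for all of them only if `D²F` vanishes along `y`.
Outside these cases, restarting at a time at which the two Hessians differ, or using a field that is
stationary at the end point, makes them differ at the initial time.
-/

section Superposition

universe u

variable {K : Type*} [TopologicalSpace K] [CompactSpace K]

/-- Pointwise application of a continuous family of operators to a continuous function, as a
bounded bilinear map for the supremum norms. -/
noncomputable def pointwiseApply {X Y : Type*} [NormedAddCommGroup X] [NormedSpace ℝ X]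
    [NormedAddCommGroup Y] [NormedSpace ℝ Y] : C(K, X →L[ℝ] Y) →L[ℝ] C(K, X) →L[ℝ] C(K, Y) :=
  LinearMap.mkContinuous₂
    (LinearMap.mk₂ ℝ (fun (A : C(K, X →L[ℝ] Y)) (v : C(K, X)) =>
        (⟨fun s => A s (v s), A.continuous.clm_apply v.continuous⟩ : C(K, Y)))
      (fun _ _ _ => by ext; simp) (fun _ _ _ => by ext; simp)
      (fun _ _ _ => by ext; simp) (fun _ _ _ => by ext; simp)) 1
    (fun A v => by
      rw [ContinuousMap.norm_le _ (by positivity), one_mul]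
      intro s
      exact ((A s).le_opNorm (v s)).trans
        (mul_le_mul (A.norm_coe_le_norm s) (v.norm_coe_le_norm s) (norm_nonneg _) (norm_nonneg A)))

theorem hasFDerivAt_superposition {X Y : Type*} [NormedAddCommGroup X] [NormedSpace ℝ X]
    [NormedAddCommGroup Y] [NormedSpace ℝ Y] (F : C(X, Y)) (F' : C(X, X →L[ℝ] Y))
    (hF : ∀ x, HasFDerivAt F (F' x) x) (z : C(K, X)) :
    HasFDerivAt (fun z : C(K, X) => F.comp z) (pointwiseApply (F'.comp z)) z := by
  rw [hasFDerivAt_iff_isLittleO_nhds_zero, Asymptotics.isLittleO_iff]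
  intro c hc
  obtain ⟨δ, hδ, hclose⟩ := (Metric.continuous_iff (f := fun w : C(K, X) => F'.comp w)).1
    (ContinuousMap.continuous_postcomp F') z c hc
  filter_upwards [Metric.ball_mem_nhds (0 : C(K, X)) hδ] with v hv
  rw [mem_ball_zero_iff] at hv
  rw [ContinuousMap.norm_le _ (by positivity)]
  intro s
  have hF'_close : ∀ x ∈ Metric.ball (z s) δ, ‖F' x - F' (z s)‖ ≤ c := fun x hx => by
    have hshift := hclose (z + ContinuousMap.const K (x - z s)) (by
      rw [dist_eq_norm, add_sub_cancel_left]
      exact ((ContinuousMap.norm_le _ (norm_nonneg _)).2 fun _ => le_rfl).trans_lt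
        (mem_ball_iff_norm.1 hx))
    simpa [dist_eq_norm] using (ContinuousMap.dist_apply_le_dist s).trans hshift.le
  have hmem : z s + v s ∈ Metric.ball (z s) δ := by
    rw [mem_ball_iff_norm, add_sub_cancel_left]
    exact (v.norm_coe_le_norm s).trans_lt hv
  have hmean := (convex_ball (z s) δ).norm_image_sub_le_of_norm_hasFDerivWithin_le'
    (fun x _ => (hF x).hasFDerivWithinAt) hF'_close (Metric.mem_ball_self hδ) hmem
  rw [add_sub_cancel_left] at hmean
  exact hmean.trans (mul_le_mul_of_nonneg_left (v.norm_coe_le_norm s) hc.le)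

theorem contDiff_superposition_nat {X : Type u} [NormedAddCommGroup X] [NormedSpace ℝ X] (n : ℕ) :
    ∀ {Y : Type u} [NormedAddCommGroup Y] [NormedSpace ℝ Y] (F : C(X, Y)), ContDiff ℝ n F →
      ContDiff ℝ n (fun z : C(K, X) => F.comp z) := by
  induction n with
  | zero => exact fun F _ => contDiff_zero.2 (ContinuousMap.continuous_postcomp F)
  | succ n ih =>
    intro Y _ _ F hF
    have hF' : ContDiff ℝ n (fderiv ℝ F) := hF.fderiv_right (by norm_cast)
    rw [Nat.cast_succ, contDiff_succ_iff_hasFDerivAt]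
    exact ⟨_, pointwiseApply.contDiff.comp (ih ⟨fderiv ℝ F, hF'.continuous⟩ hF'),
      hasFDerivAt_superposition F _ fun x => (hF.differentiable (by simp) x).hasFDerivAt⟩

theorem contDiff_superposition {X Y : Type u} [NormedAddCommGroup X] [NormedSpace ℝ X]
    [NormedAddCommGroup Y] [NormedSpace ℝ Y] {n : ℕ∞} (F : C(X, Y)) (hF : ContDiff ℝ n F) :
    ContDiff ℝ n (fun z : C(K, X) => F.comp z) :=
  contDiff_iff_forall_nat_le.2 fun m hm =>
    contDiff_superposition_nat m F (contDiff_iff_forall_nat_le.1 hF m hm)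

end Superposition

section Volterra

variable {X : Type*} [NormedAddCommGroup X] {a b : ℝ}

theorem intervalIntegrable_IccExtend (hab : a ≤ b) (v : C(Icc a b, X)) (s t : ℝ) :
    IntervalIntegrable (IccExtend hab v) MeasureTheory.volume s t :=
  v.continuous.Icc_extend'.intervalIntegrable s t

variable [NormedSpace ℝ X]

theorem hasDerivAt_integral_IccExtend [CompleteSpace X] (hab : a ≤ b) (t₀ : ℝ)
    (v : C(Icc a b, X)) (t : ℝ) :
    HasDerivAt (fun u => ∫ s in t₀..u, IccExtend hab v s) (IccExtend hab v t) t :=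
  (v.continuous.Icc_extend'.integral_hasStrictDerivAt t₀ t).hasDerivAt

theorem abs_sub_le_sub_of_mem_Icc {s t : ℝ} (hs : s ∈ Icc a b) (ht : t ∈ Icc a b) :
    |t - s| ≤ b - a := by
  rw [← Real.dist_eq, ← Real.diam_Icc (hs.1.trans hs.2)]
  exact Metric.dist_le_diam_of_mem (Metric.isBounded_Icc a b) ht hs

theorem norm_integral_IccExtend_le (hab : a ≤ b) {s t : ℝ} (v : C(Icc a b, X))
    (hs : s ∈ Icc a b) (ht : t ∈ Icc a b) :
    ‖∫ u in s..t, IccExtend hab v u‖ ≤ (b - a) * ‖v‖ := by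
  refine (intervalIntegral.norm_integral_le_of_norm_le_const
    fun u _ => v.norm_coe_le_norm _).trans ?_
  rw [mul_comm]
  gcongr
  exact abs_sub_le_sub_of_mem_Icc hs ht

/-- The primitive of a continuous function on `[a, b]` that vanishes at `t₀`, as a bounded
operator for the supremum norm. -/
noncomputable def primitive [CompleteSpace X] (hab : a ≤ b) (t₀ : Icc a b) :
    C(Icc a b, X) →L[ℝ] C(Icc a b, X) :=
  LinearMap.mkContinuous
    { toFun := fun v => ⟨fun t => ∫ s in (t₀ : ℝ)..t, IccExtend hab v s,
        (continuous_iff_continuousAt.2 fun t =>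
          (hasDerivAt_integral_IccExtend hab t₀ v t).continuousAt).comp continuous_subtype_val⟩
      map_add' := fun v w => by
        ext t
        exact intervalIntegral.integral_add (intervalIntegrable_IccExtend hab v _ _)
          (intervalIntegrable_IccExtend hab w _ _)
      map_smul' := fun c v => by
        ext t
        exact intervalIntegral.integral_smul c _ } (b - a)
    (fun v => (ContinuousMap.norm_le _ (mul_nonneg (sub_nonneg.2 hab) (norm_nonneg _))).2
      fun t => norm_integral_IccExtend_le hab v t₀.2 t.2)

theorem primitive_apply [CompleteSpace X] (hab : a ≤ b) (t₀ t : Icc a b) (v : C(Icc a b, X)) :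
    primitive hab t₀ v t = ∫ s in (t₀ : ℝ)..t, IccExtend hab v s :=
  rfl

/-- The Volterra operator `v ↦ (t ↦ ∫ s in t₀..t, A s (v s))`. -/
noncomputable def volterra [CompleteSpace X] (hab : a ≤ b) (t₀ : Icc a b)
    (A : C(Icc a b, X →L[ℝ] X)) : C(Icc a b, X) →L[ℝ] C(Icc a b, X) :=
  primitive hab t₀ ∘L pointwiseApply A

theorem norm_volterra_pow_apply_le [CompleteSpace X] (hab : a ≤ b) (t₀ : Icc a b)
    (A : C(Icc a b, X →L[ℝ] X)) (v : C(Icc a b, X)) (n : ℕ) (t : Icc a b) :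
    ‖(volterra hab t₀ A ^ n) v t‖ ≤ (‖A‖ ^ n * ‖v‖ / n.factorial) * |(t : ℝ) - t₀| ^ n := by
  induction n generalizing t with
  | zero => simpa using v.norm_coe_le_norm t
  | succ n ih =>
    set u := (volterra hab t₀ A ^ n) v with hu
    have hbound : ∀ s ∈ uIoc (t₀ : ℝ) t, ‖IccExtend hab (pointwiseApply A u) s‖ ≤
        (‖A‖ * (‖A‖ ^ n * ‖v‖ / n.factorial)) * |s - t₀| ^ n := fun s hs => by
      have hs' : s ∈ Icc a b := uIoc_subset_uIcc.trans (uIcc_subset_Icc t₀.2 t.2) hs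
      rw [IccExtend_of_mem hab _ hs', mul_assoc]
      exact ((A _).le_opNorm _).trans
        (mul_le_mul (A.norm_coe_le_norm _) (ih ⟨s, hs'⟩) (norm_nonneg _) (norm_nonneg A))
    calc ‖(volterra hab t₀ A ^ (n + 1)) v t‖
        = ‖∫ s in uIoc (t₀ : ℝ) t, IccExtend hab (pointwiseApply A u) s‖ := by
          rw [pow_succ', ← intervalIntegral.norm_intervalIntegral_eq, hu]
          rfl
      _ ≤ ∫ s in uIoc (t₀ : ℝ) t, (‖A‖ * (‖A‖ ^ n * ‖v‖ / n.factorial)) * |s - t₀| ^ n :=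
          MeasureTheory.norm_integral_le_of_norm_le (Continuous.integrableOn_uIoc (by fun_prop))
            ((MeasureTheory.ae_restrict_mem measurableSet_uIoc).mono hbound)
      _ = (‖A‖ ^ (n + 1) * ‖v‖ / (n + 1).factorial) * |(t : ℝ) - t₀| ^ (n + 1) := by
          rw [MeasureTheory.integral_const_mul, integral_pow_abs_sub_uIoc, Nat.factorial_succ]
          push_cast
          field_simp
          ring

theorem exists_norm_volterra_pow_lt_one [CompleteSpace X] (hab : a ≤ b) (t₀ : Icc a b)
    (A : C(Icc a b, X →L[ℝ] X)) : ∃ n, ‖volterra hab t₀ A ^ n‖ < 1 := by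
  obtain ⟨n, hn⟩ := ((FloorSemiring.tendsto_pow_div_factorial_atTop (‖A‖ * (b - a))).eventually
    (gt_mem_nhds one_pos)).exists
  have : 0 ≤ b - a := sub_nonneg.2 hab
  refine ⟨n, (ContinuousLinearMap.opNorm_le_bound _ (by positivity) fun v =>
    (ContinuousMap.norm_le _ (by positivity)).2 fun t => ?_).trans_lt hn⟩
  calc ‖(volterra hab t₀ A ^ n) v t‖
      ≤ (‖A‖ ^ n * ‖v‖ / n.factorial) * |(t : ℝ) - t₀| ^ n :=
        norm_volterra_pow_apply_le hab t₀ A v n t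
    _ ≤ (‖A‖ ^ n * ‖v‖ / n.factorial) * (b - a) ^ n := by
        gcongr
        exact abs_sub_le_sub_of_mem_Icc t₀.2 t.2
    _ = (‖A‖ * (b - a)) ^ n / n.factorial * ‖v‖ := by rw [mul_pow]; ring

theorem isUnit_one_sub_of_norm_pow_lt_one {R : Type*} [NormedRing R] [HasSummableGeomSeries R]
    {x : R} {n : ℕ} (h : ‖x ^ n‖ < 1) : IsUnit (1 - x) := by
  have hcomm : Commute (1 - x) (∑ i ∈ Finset.range n, x ^ i) :=
    Commute.sum_right _ _ _ fun i _ => ((Commute.one_left x).sub_left (Commute.refl x)).pow_right i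
  have hprod := isUnit_one_sub_of_norm_lt_one h
  rw [← mul_neg_geom_sum] at hprod
  exact (hcomm.isUnit_mul_iff.1 hprod).1

theorem isUnit_one_sub_volterra [CompleteSpace X] (hab : a ≤ b) (t₀ : Icc a b)
    (A : C(Icc a b, X →L[ℝ] X)) : IsUnit (1 - volterra hab t₀ A) :=
  let ⟨_, hn⟩ := exists_norm_volterra_pow_lt_one hab t₀ A
  isUnit_one_sub_of_norm_pow_lt_one (R := C(Icc a b, X) →L[ℝ] C(Icc a b, X)) hn

theorem eqOn_Icc_of_hasDerivWithinAt_eq {z w g : ℝ → X} {t₀ : ℝ} (ht₀ : t₀ ∈ Icc a b)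
    (hz : ∀ t ∈ Icc a b, HasDerivWithinAt z (g t) (Icc a b) t)
    (hw : ∀ t ∈ Icc a b, HasDerivWithinAt w (g t) (Icc a b) t) (h : z t₀ = w t₀) :
    EqOn z w (Icc a b) := by
  intro t ht
  have := (convex_Icc a b).norm_image_sub_le_of_norm_hasDerivWithin_le (C := 0)
    (f := fun s => z s - w s) (f' := fun s => g s - g s)
    (fun s hs => (hz s hs).sub (hw s hs)) (fun s _ => by simp) ht₀ ht
  simpa [h, sub_eq_zero] using this

theorem hasDerivWithinAt_IccExtend_const_add_primitive [CompleteSpace X] (hab : a ≤ b)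
    (t₀ : Icc a b) (x : X) (v : C(Icc a b, X)) (t : Icc a b) :
    HasDerivWithinAt (IccExtend hab ⇑(ContinuousMap.const (Icc a b) x + primitive hab t₀ v))
      (v t) (Icc a b) t := by
  have hderiv := ((hasDerivAt_integral_IccExtend hab t₀ v t).const_add x).hasDerivWithinAt
    (s := Icc a b)
  rw [IccExtend_val] at hderiv
  exact hderiv.congr (fun s hs => IccExtend_of_mem hab _ hs) (IccExtend_val hab _ t)

theorem eq_const_add_primitive_iff [CompleteSpace X] (hab : a ≤ b) (t₀ : Icc a b) {x : X}
    {z v : C(Icc a b, X)} : z = ContinuousMap.const _ x + primitive hab t₀ v ↔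
      z t₀ = x ∧ ∀ t : Icc a b, HasDerivWithinAt (IccExtend hab z) (v t) (Icc a b) t := by
  have hinit : (ContinuousMap.const (Icc a b) x + primitive hab t₀ v) t₀ = x := by
    simp [primitive_apply]
  constructor
  · rintro rfl
    exact ⟨hinit, hasDerivWithinAt_IccExtend_const_add_primitive hab t₀ x v⟩
  · rintro ⟨hx, hz⟩
    ext t
    have := eqOn_Icc_of_hasDerivWithinAt_eq (g := IccExtend hab v) t₀.2
      (fun s hs => by simpa only [IccExtend_of_mem hab v hs] using hz ⟨s, hs⟩)
      (fun s hs => by simpa only [IccExtend_of_mem hab v hs] using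
        hasDerivWithinAt_IccExtend_const_add_primitive hab t₀ x v ⟨s, hs⟩)
      (by rw [IccExtend_val, IccExtend_val, hx, hinit]) t.2
    rwa [IccExtend_val, IccExtend_val] at this

theorem exists_hasDerivWithinAt_linear [CompleteSpace X] {A : ℝ → X →L[ℝ] X} {B : ℝ → X}
    (hA : ContinuousOn A (Icc a b)) (hB : ContinuousOn B (Icc a b)) {t₀ : ℝ} (ht₀ : t₀ ∈ Icc a b)
    (x : X) :
    ∃ z : ℝ → X, z t₀ = x ∧
      ∀ t ∈ Icc a b, HasDerivWithinAt z (A t (z t) + B t) (Icc a b) t := by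
  have hab : a ≤ b := ht₀.1.trans ht₀.2
  let A' : C(Icc a b, X →L[ℝ] X) := ⟨_, hA.domRestrict⟩
  let B' : C(Icc a b, X) := ⟨_, hB.domRestrict⟩
  obtain ⟨z, hz⟩ := (ContinuousLinearMap.isUnit_iff_bijective.1
    (isUnit_one_sub_volterra hab ⟨t₀, ht₀⟩ A')).2
      (ContinuousMap.const _ x + primitive hab ⟨t₀, ht₀⟩ B')
  have heq : z = ContinuousMap.const _ x + primitive hab ⟨t₀, ht₀⟩ (pointwiseApply A' z + B') := by
    rw [map_add, ← add_assoc, add_right_comm, ← hz]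
    simp [volterra]
  obtain ⟨hx, hderiv⟩ := (eq_const_add_primitive_iff hab ⟨t₀, ht₀⟩).1 heq
  refine ⟨IccExtend hab z, by rwa [IccExtend_of_mem hab _ ht₀], fun t ht => ?_⟩
  rw [IccExtend_of_mem hab _ ht]
  exact hderiv ⟨t, ht⟩

end Volterra

section SmoothDependence

theorem IccExtend_domRestrict_eqOn {α : Type*} {a b : ℝ} (hab : a ≤ b) (y : ℝ → α) :
    EqOn (IccExtend hab ((Icc a b).domRestrict y)) y (Icc a b) :=
  fun _ ht => IccExtend_of_mem hab _ ht

variable {X : Type*} [NormedAddCommGroup X] [NormedSpace ℝ X] {F Φ : X → X} {a b : ℝ}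
  {y w z : ℝ → X}

theorem isIntegralCurveOn_Icc_eqOn_of_left_eq (hF : ContDiff ℝ 1 F)
    (hy : IsIntegralCurveOn y (fun _ => F) (Icc a b))
    (hz : IsIntegralCurveOn z (fun _ => F) (Icc a b)) (h : y a = z a) : EqOn y z (Icc a b) := by
  let S := y '' Icc a b ∪ z '' Icc a b
  have hS : IsCompact S := (isCompact_Icc.image_of_continuousOn hy.continuousOn).union
    (isCompact_Icc.image_of_continuousOn hz.continuousOn)
  obtain ⟨K, hK⟩ := hF.locallyLipschitz.locallyLipschitzOn.exists_lipschitzOnWith_of_compact hS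
  have hderiv : ∀ {u : ℝ → X}, IsIntegralCurveOn u (fun _ => F) (Icc a b) →
      ∀ t ∈ Ico a b, HasDerivWithinAt u (F (u t)) (Ici t) t := fun hu t ht =>
    (hu t (Ico_subset_Icc_self ht)).mono_of_mem_nhdsWithin (Icc_mem_nhdsGE_of_mem ht)
  exact ODE_solution_unique_of_mem_Icc_right (v := fun _ => F) (s := fun _ => S)
    (fun _ _ => hK)
    hy.continuousOn (hderiv hy)
    (fun t ht => Or.inl (mem_image_of_mem y (Ico_subset_Icc_self ht)))
    hz.continuousOn (hderiv hz)
    (fun t ht => Or.inr (mem_image_of_mem z (Ico_subset_Icc_self ht))) h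

/-- `w` solves the variational equation `w' = DF(y) w` along `y` on `[a, b]`. -/
def IsVariation (F : X → X) (a b : ℝ) (y w : ℝ → X) : Prop :=
  IsIntegralCurveOn w (fun t => fderiv ℝ F (y t)) (Icc a b)

theorem exists_isVariation [CompleteSpace X] (hF : ContDiff ℝ 1 F)
    (hy : ContinuousOn y (Icc a b)) {t₀ : ℝ} (ht₀ : t₀ ∈ Icc a b) (v : X) :
    ∃ w : ℝ → X, w t₀ = v ∧ IsVariation F a b y w := by
  obtain ⟨w, hw₀, hw⟩ := exists_hasDerivWithinAt_linear (B := fun _ => (0 : X))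
    ((hF.continuous_fderiv one_ne_zero).comp_continuousOn hy) continuousOn_const ht₀ v
  exact ⟨w, hw₀, fun t ht => by simpa using hw t ht⟩

/-- The defect `z ↦ z - ∫ s in a.., F (z s)` of the Picard iteration on `C([a, b], X)`: its value
is the constant `x` exactly at the solution of `z' = F(z)` with `z(a) = x`. -/
noncomputable def picardDefect [CompleteSpace X] (hab : a ≤ b) (F : C(X, X))
    (z : C(Icc a b, X)) : C(Icc a b, X) :=
  z - primitive hab ⟨a, left_mem_Icc.2 hab⟩ (F.comp z)

theorem picardDefect_eq_const_iff [CompleteSpace X] (hab : a ≤ b) {F : C(X, X)} {x : X}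
    {z : C(Icc a b, X)} : picardDefect hab F z = ContinuousMap.const _ x ↔
      IccExtend hab z a = x ∧ IsIntegralCurveOn (IccExtend hab z) (fun _ => F) (Icc a b) := by
  rw [picardDefect, sub_eq_iff_eq_add, eq_const_add_primitive_iff,
    IccExtend_of_mem hab z (left_mem_Icc.2 hab)]
  refine and_congr_right fun _ => ⟨fun h t ht => ?_, fun h t => ?_⟩
  · rw [IccExtend_of_mem hab z ht]
    exact h ⟨t, ht⟩
  · exact (h t t.2).congr_deriv (congrArg F (IccExtend_val hab z t))

theorem contDiff_picardDefect [CompleteSpace X] (hab : a ≤ b) {n : ℕ∞} {F : C(X, X)}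
    (hF : ContDiff ℝ n F) : ContDiff ℝ n (picardDefect hab F) :=
  contDiff_id.sub ((primitive hab _).contDiff.comp (contDiff_superposition F hF))

theorem hasFDerivAt_picardDefect [CompleteSpace X] (hab : a ≤ b) {F : C(X, X)}
    {F' : C(X, X →L[ℝ] X)} (hF : ∀ x, HasFDerivAt F (F' x) x) (z : C(Icc a b, X)) :
    HasFDerivAt (picardDefect hab F)
      (1 - volterra hab ⟨a, left_mem_Icc.2 hab⟩ (F'.comp z)) z := by
  have hprimitive := (primitive hab ⟨a, left_mem_Icc.2 hab⟩).hasFDerivAt.comp z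
    (hasFDerivAt_superposition F F' hF z)
  exact (hasFDerivAt_id z).sub hprimitive

/-- The derivative of the Picard defect is invertible on the whole of `[a, b]`, however long, so
that one application of the inverse function theorem gives the solutions up to time `b`. -/
theorem exists_contDiffAt_solution [CompleteSpace X] {n : ℕ∞} (hn : n ≠ 0)
    (hF : ContDiff ℝ n F) (hab : a ≤ b) (hy : IsIntegralCurveOn y (fun _ => F) (Icc a b)) :
    ∃ S : X → C(Icc a b, X), ContDiffAt ℝ n S (y a) ∧
      ∀ᶠ x in 𝓝 (y a), IccExtend hab (S x) a = x ∧
        IsIntegralCurveOn (IccExtend hab (S x)) (fun _ => F) (Icc a b) := by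
  have hn' : (n : WithTop ℕ∞) ≠ 0 := mod_cast hn
  let Fc : C(X, X) := ⟨F, hF.continuous⟩
  let F' : C(X, X →L[ℝ] X) := ⟨fderiv ℝ F, hF.continuous_fderiv hn'⟩
  let yc : C(Icc a b, X) := ⟨_, hy.continuousOn.domRestrict⟩
  have hΨ : ContDiffAt ℝ n (picardDefect hab Fc) yc := (contDiff_picardDefect hab hF).contDiffAt
  obtain ⟨u, hu⟩ := isUnit_one_sub_volterra hab ⟨a, left_mem_Icc.2 hab⟩ (F'.comp yc)
  have hΨ' : HasFDerivAt (picardDefect hab Fc)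
      (ContinuousLinearEquiv.unitsEquiv ℝ _ u : C(Icc a b, X) →L[ℝ] C(Icc a b, X)) yc :=
    (hasFDerivAt_picardDefect hab (F' := F')
      (fun x => (hF.differentiable hn' x).hasFDerivAt) yc).congr_fderiv hu.symm
  have hyc : picardDefect hab Fc yc = ContinuousMap.const _ (y a) := by
    have heq := IccExtend_domRestrict_eqOn hab y
    refine (picardDefect_eq_const_iff hab).2 ⟨heq (left_mem_Icc.2 hab), fun t ht => ?_⟩
    exact ((hy t ht).congr heq (heq ht)).congr_deriv (congrArg F (heq ht).symm)
  have hG := hΨ.to_localInverse hΨ' hn'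
  have hright := (hΨ.hasStrictFDerivAt' hΨ' hn').eventually_right_inverse
  rw [hyc] at hG hright
  let const : X →L[ℝ] C(Icc a b, X) := ContinuousLinearMap.const ℝ (Icc a b)
  refine ⟨fun x => hΨ.localInverse hΨ' hn' (const x), hG.comp (y a) const.contDiff.contDiffAt, ?_⟩
  filter_upwards [const.continuous.continuousAt.eventually hright] with x hx
  exact (picardDefect_eq_const_iff hab).1 hx

theorem IccExtend_fderiv_solution_eqOn [CompleteSpace X] (hF : ContDiff ℝ 1 F) (hab : a ≤ b)
    (hy : IsIntegralCurveOn y (fun _ => F) (Icc a b)) {S : X → C(Icc a b, X)}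
    (hS : DifferentiableAt ℝ S (y a))
    (hsol : ∀ᶠ x in 𝓝 (y a), IccExtend hab (S x) a = x ∧
      IsIntegralCurveOn (IccExtend hab (S x)) (fun _ => F) (Icc a b))
    (hw : IsVariation F a b y w) :
    EqOn (IccExtend hab (fderiv ℝ S (y a) (w a))) w (Icc a b) := by
  let Fc : C(X, X) := ⟨F, hF.continuous⟩
  let F' : C(X, X →L[ℝ] X) := ⟨fderiv ℝ F, hF.continuous_fderiv one_ne_zero⟩
  let wc : C(Icc a b, X) := ⟨_, ContinuousOn.domRestrict (fun t ht => (hw t ht).continuousWithinAt)⟩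
  let A := F'.comp (S (y a))
  have hSy : EqOn (IccExtend hab (S (y a))) y (Icc a b) :=
    isIntegralCurveOn_Icc_eqOn_of_left_eq hF hsol.self_of_nhds.2 hy hsol.self_of_nhds.1
  have hdefect : (fun x => picardDefect hab Fc (S x)) =ᶠ[𝓝 (y a)]
      ContinuousLinearMap.const ℝ (Icc a b) :=
    hsol.mono fun x hx => (picardDefect_eq_const_iff hab).2 hx
  have hfderiv := ((hasFDerivAt_picardDefect hab (F := Fc) (F' := F')
    (fun x => (hF.differentiable one_ne_zero x).hasFDerivAt) _).comp (y a) hS.hasFDerivAt).unique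
      ((ContinuousLinearMap.hasFDerivAt _).congr_of_eventuallyEq hdefect)
  have hwc : wc = ContinuousMap.const _ (w a) +
      primitive hab ⟨a, left_mem_Icc.2 hab⟩ (pointwiseApply A wc) := by
    have heq := IccExtend_domRestrict_eqOn hab w
    refine (eq_const_add_primitive_iff hab _).2 ⟨rfl, fun t => ?_⟩
    refine ((hw t t.2).congr heq (heq t.2)).congr_deriv ?_
    exact congrArg (fun x => fderiv ℝ F x (w t)) ((hSy t.2).symm.trans (IccExtend_val hab _ t))
  have hS' : fderiv ℝ S (y a) (w a) = wc := by
    refine (ContinuousLinearMap.isUnit_iff_bijective.1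
      (isUnit_one_sub_volterra hab ⟨a, left_mem_Icc.2 hab⟩ A)).1 ?_
    exact (DFunLike.congr_fun hfderiv (w a)).trans (sub_eq_iff_eq_add.2 hwc).symm
  rw [hS']
  exact IccExtend_domRestrict_eqOn hab w

theorem eventually_exists_isIntegralCurveOn [CompleteSpace X] (hF : ContDiff ℝ 1 F) (hab : a ≤ b)
    (hy : IsIntegralCurveOn y (fun _ => F) (Icc a b)) :
    ∀ᶠ x in 𝓝 (y a), ∃ z : ℝ → X, IsIntegralCurveOn z (fun _ => F) (Icc a b) ∧ z a = x := by
  obtain ⟨S, -, hS⟩ := exists_contDiffAt_solution (n := 1) one_ne_zero hF hab hy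
  exact hS.mono fun x hx => ⟨_, hx.2, hx.1⟩

/-- `Φ` is an end map of `F` on `[a, b]`: it sends the initial value at time `a` of each solution
of `z' = F(z)` to the value at time `b`. Nothing is required at the other points. -/
def IsEndMap (F : X → X) (a b : ℝ) (Φ : X → X) : Prop :=
  ∀ z : ℝ → X, IsIntegralCurveOn z (fun _ => F) (Icc a b) → Φ (z a) = z b

theorem IsEndMap.eventuallyEq_eval (hΦ : IsEndMap F a b Φ) (hab : a ≤ b) {x₀ : X}
    {S : X → C(Icc a b, X)}
    (hsol : ∀ᶠ x in 𝓝 x₀, IccExtend hab (S x) a = x ∧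
      IsIntegralCurveOn (IccExtend hab (S x)) (fun _ => F) (Icc a b)) :
    Φ =ᶠ[𝓝 x₀] ContinuousMap.evalCLM ℝ (⟨b, right_mem_Icc.2 hab⟩ : Icc a b) ∘ S := by
  filter_upwards [hsol] with x hx
  simpa only [hx.1, IccExtend_right, Function.comp_apply, ContinuousMap.evalCLM_apply]
    using hΦ _ hx.2

theorem IsEndMap.contDiffAt [CompleteSpace X] {n : ℕ∞} (hn : n ≠ 0) (hF : ContDiff ℝ n F)
    (hΦ : IsEndMap F a b Φ) (hab : a ≤ b) (hy : IsIntegralCurveOn y (fun _ => F) (Icc a b)) :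
    ContDiffAt ℝ n Φ (y a) := by
  obtain ⟨S, hS, hsol⟩ := exists_contDiffAt_solution hn hF hab hy
  exact ((ContinuousMap.evalCLM ℝ _).contDiff.contDiffAt.comp (y a) hS).congr_of_eventuallyEq
    (hΦ.eventuallyEq_eval hab hsol)

theorem IsEndMap.fderiv_apply [CompleteSpace X] (hF : ContDiff ℝ 1 F) (hΦ : IsEndMap F a b Φ)
    (hab : a ≤ b) (hy : IsIntegralCurveOn y (fun _ => F) (Icc a b)) (hw : IsVariation F a b y w) :
    fderiv ℝ Φ (y a) (w a) = w b := by
  obtain ⟨S, hS, hsol⟩ := exists_contDiffAt_solution (n := 1) one_ne_zero hF hab hy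
  have hS' := hS.differentiableAt one_ne_zero
  have hΦ' := (ContinuousLinearMap.hasFDerivAt _).comp (y a) hS'.hasFDerivAt
    |>.congr_of_eventuallyEq (hΦ.eventuallyEq_eval hab hsol)
  rw [hΦ'.fderiv, ← IccExtend_fderiv_solution_eqOn hF hab hy hS' hsol hw (right_mem_Icc.2 hab)]
  exact (IccExtend_right hab _).symm

end SmoothDependence

section Adjoint

variable {X V : Type*} [NormedAddCommGroup X] [NormedSpace ℝ X] [NormedAddCommGroup V]
  [NormedSpace ℝ V] {F Φ : X → X} {ℓ : X → V} {a b : ℝ} {y w : ℝ → X} {p : ℝ → X →L[ℝ] V}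

/-- `p` solves the adjoint equation `p' = -p ∘ DF(y)` along `y` on `[a, b]`. -/
def IsAdjointSolution (F : X → X) (a b : ℝ) (y : ℝ → X) (p : ℝ → X →L[ℝ] V) : Prop :=
  ∀ t ∈ Icc a b, HasDerivWithinAt p (-(p t ∘L fderiv ℝ F (y t))) (Icc a b) t

theorem exists_isAdjointSolution [CompleteSpace V] (hF : ContDiff ℝ 1 F)
    (hy : ContinuousOn y (Icc a b)) {t₀ : ℝ} (ht₀ : t₀ ∈ Icc a b) (p₀ : X →L[ℝ] V) :
    ∃ p : ℝ → X →L[ℝ] V, p t₀ = p₀ ∧ IsAdjointSolution F a b y p := by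
  have hDF : ContinuousOn (fun t => fderiv ℝ F (y t)) (Icc a b) :=
    (hF.continuous_fderiv one_ne_zero).comp_continuousOn hy
  obtain ⟨p, hp₀, hp⟩ := exists_hasDerivWithinAt_linear
    (A := fun t => -(ContinuousLinearMap.compL ℝ X X V).flip (fderiv ℝ F (y t)))
    ((ContinuousLinearMap.continuous _).comp_continuousOn hDF).neg
    (continuousOn_const (c := 0)) ht₀ p₀
  exact ⟨p, hp₀, fun t ht => (hp t ht).congr_deriv (add_zero _)⟩

theorem IsAdjointSolution.apply_eq_apply (hp : IsAdjointSolution F a b y p)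
    (hw : IsVariation F a b y w) {s t : ℝ} (hs : s ∈ Icc a b) (ht : t ∈ Icc a b) :
    p s (w s) = p t (w t) := by
  refine eqOn_Icc_of_hasDerivWithinAt_eq (z := fun u => p u (w u)) (w := fun _ => p t (w t)) ht
    (g := fun _ => 0) (fun u hu => ?_) (fun _ _ => hasDerivWithinAt_const _ _ _) rfl hs
  exact ((hp u hu).clm_apply (hw u hu)).congr_deriv (neg_add_cancel _)

variable [CompleteSpace X]

theorem IsAdjointSolution.eq_comp_fderiv (hF : ContDiff ℝ 1 F) (hΦ : IsEndMap F a b Φ)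
    (hab : a ≤ b) (hy : IsIntegralCurveOn y (fun _ => F) (Icc a b))
    (hp : IsAdjointSolution F a b y p) : p a = p b ∘L fderiv ℝ Φ (y a) := by
  ext v
  obtain ⟨w, rfl, hw⟩ := exists_isVariation hF hy.continuousOn (left_mem_Icc.2 hab) v
  rw [ContinuousLinearMap.comp_apply, hΦ.fderiv_apply hF hab hy hw]
  exact hp.apply_eq_apply hw (left_mem_Icc.2 hab) (right_mem_Icc.2 hab)

theorem IsAdjointSolution.fderiv_comp_eq (hF : ContDiff ℝ 1 F) (hΦ : IsEndMap F a b Φ)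
    (hab : a ≤ b) (hy : IsIntegralCurveOn y (fun _ => F) (Icc a b))
    (hp : IsAdjointSolution F a b y p) (hℓ : HasFDerivAt ℓ (p b) (y b)) :
    fderiv ℝ (ℓ ∘ Φ) (y a) = p a := by
  rw [← hΦ y hy] at hℓ
  rw [hp.eq_comp_fderiv hF hΦ hab hy]
  exact (hℓ.comp (y a) ((hΦ.contDiffAt (n := 1) one_ne_zero hF hab hy).differentiableAt
    one_ne_zero).hasFDerivAt).fderiv

end Adjoint

section Prolongation

variable {X V : Type*} [NormedAddCommGroup X] [NormedSpace ℝ X] [NormedAddCommGroup V]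
  [NormedSpace ℝ V] {F Φ : X → X} {ℓ : X → V} {a b : ℝ} {y w : ℝ → X} {p : ℝ → X →L[ℝ] V}
  {c H : ℝ → X →L[ℝ] X →L[ℝ] V}

/-- The second derivative of `f` at `x`. The first argument is the direction of the inner
derivative and the second one that of the outer derivative, in the order of the indices of
`f_{,ij}`. -/
noncomputable def secondDeriv (f : X → V) (x : X) : X →L[ℝ] X →L[ℝ] V :=
  (fderiv ℝ (fderiv ℝ f) x).flip

/-- The derivative of `f` as a function of the base point and of the direction. -/
noncomputable def fderivApply (f : X → V) (q : X × X) : V :=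
  fderiv ℝ f q.1 q.2

/-- The first prolongation of `F` to `X × X`, whose solutions are the solutions of `x' = F(x)`
together with the variations along them. -/
noncomputable def prolong (F : X → X) (q : X × X) : X × X :=
  (F q.1, fderivApply F q)

/-- The operator `H ↦ H(A ·, ·) + H(·, A ·)` on bilinear maps, as a linear function of `A`. -/
noncomputable def bilinAction :
    (X →L[ℝ] X) →L[ℝ] (X →L[ℝ] X →L[ℝ] V) →L[ℝ] (X →L[ℝ] X →L[ℝ] V) :=
  (ContinuousLinearMap.compL ℝ X X (X →L[ℝ] V)).flip +
    ContinuousLinearMap.compL ℝ X (X →L[ℝ] V) (X →L[ℝ] V) ∘L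
      (ContinuousLinearMap.compL ℝ X X V).flip

theorem bilinAction_apply (A : X →L[ℝ] X) (H : X →L[ℝ] X →L[ℝ] V) (u v : X) :
    bilinAction A H u v = H (A u) v + H u (A v) :=
  rfl

/-- The bilinear map `p ∘ D²F(x)`, the coordinate-free form of the term `σ_m F_{m,ij}`. -/
noncomputable def curvature (F : X → X) (x : X) (p : X →L[ℝ] V) : X →L[ℝ] X →L[ℝ] V :=
  ContinuousLinearMap.compL ℝ X X V p ∘L secondDeriv F x

theorem curvature_apply (F : X → X) (x : X) (p : X →L[ℝ] V) (u v : X) :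
    curvature F x p u v = p (secondDeriv F x u v) :=
  rfl

theorem secondDeriv_clm_comp (p : X →L[ℝ] V) (hF : ContDiff ℝ 2 F) (x : X) :
    secondDeriv (p ∘ F) x = curvature F x p := by
  have hcomp : fderiv ℝ (p ∘ F) = fun z => p ∘L fderiv ℝ F z :=
    funext fun z => (p.hasFDerivAt.comp z (hF.differentiable two_ne_zero z).hasFDerivAt).fderiv
  have hDF := (((hF.fderiv_right (m := 1) (by norm_num)).differentiable one_ne_zero) x).hasFDerivAt
  ext u v
  rw [secondDeriv, hcomp, ((hasFDerivAt_const p x).clm_comp hDF).fderiv]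
  simp [curvature_apply, secondDeriv]

/-- `H` solves the second-order adjoint equation `H' = -(H(DF ·, ·) + H(·, DF ·) + c)` with source
`c` along `y` on `[a, b]`. -/
def IsSecondAdjointSolution (F : X → X) (a b : ℝ) (y : ℝ → X) (c H : ℝ → X →L[ℝ] X →L[ℝ] V) :
    Prop :=
  ∀ t ∈ Icc a b, HasDerivWithinAt H (-(bilinAction (fderiv ℝ F (y t)) (H t) + c t)) (Icc a b) t

theorem continuous_secondDeriv {f : X → V} (hf : ContDiff ℝ 2 f) : Continuous (secondDeriv f) :=
  (ContinuousLinearMap.flipₗᵢ ℝ X X V).continuous.comp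
    ((hf.fderiv_right (m := 1) (by norm_num)).continuous_fderiv one_ne_zero)

theorem continuousOn_curvature (hF : ContDiff ℝ 2 F) {s : Set ℝ} (hy : ContinuousOn y s)
    (hp : ContinuousOn p s) : ContinuousOn (fun t => curvature F (y t) (p t)) s :=
  ((ContinuousLinearMap.compL ℝ X X V).continuous.comp_continuousOn hp).clm_comp
    ((continuous_secondDeriv hF).comp_continuousOn hy)

theorem exists_isSecondAdjointSolution [CompleteSpace V] (hF : ContDiff ℝ 1 F)
    (hy : ContinuousOn y (Icc a b)) (hc : ContinuousOn c (Icc a b)) {t₀ : ℝ} (ht₀ : t₀ ∈ Icc a b)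
    (H₀ : X →L[ℝ] X →L[ℝ] V) : ∃ H, H t₀ = H₀ ∧ IsSecondAdjointSolution F a b y c H := by
  have hDF : ContinuousOn (fun t => fderiv ℝ F (y t)) (Icc a b) :=
    (hF.continuous_fderiv one_ne_zero).comp_continuousOn hy
  obtain ⟨H, hH₀, hH⟩ := exists_hasDerivWithinAt_linear
    (A := fun t => bilinAction (-fderiv ℝ F (y t))) (B := fun t => -c t)
    (bilinAction.continuous.comp_continuousOn hDF.neg) hc.neg ht₀ H₀
  refine ⟨H, hH₀, fun t ht => (hH t ht).congr_deriv ?_⟩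
  ext u v
  simp only [bilinAction_apply, add_apply, neg_apply, ContinuousLinearMap.map_neg]
  abel

theorem hasFDerivAt_fderivApply {f : X → V} {q : X × X} (hf : ContDiffAt ℝ 2 f q.1) :
    HasFDerivAt (fderivApply f) ((secondDeriv f q.1 q.2).coprod (fderiv ℝ f q.1)) q := by
  have hDf := ((hf.fderiv_right (m := 1) (by norm_num)).differentiableAt one_ne_zero).hasFDerivAt
  refine ((hDf.comp q hasFDerivAt_fst).clm_apply hasFDerivAt_snd).congr_fderiv ?_
  ext v <;> simp [secondDeriv]

theorem contDiff_fderivApply {f : X → V} (hf : ContDiff ℝ 2 f) : ContDiff ℝ 1 (fderivApply f) :=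
  ((hf.fderiv_right (m := 1) (by norm_num)).comp contDiff_fst).clm_apply contDiff_snd

theorem contDiff_prolong (hF : ContDiff ℝ 2 F) : ContDiff ℝ 1 (prolong F) :=
  ((hF.of_le (by norm_num)).comp contDiff_fst).prodMk (contDiff_fderivApply hF)

theorem fderiv_prolong (hF : ContDiff ℝ 2 F) (q : X × X) :
    fderiv ℝ (prolong F) q = ((fderiv ℝ F q.1).comp (ContinuousLinearMap.fst ℝ X X)).prod
      ((secondDeriv F q.1 q.2).coprod (fderiv ℝ F q.1)) :=
  ((((hF.differentiable two_ne_zero) q.1).hasFDerivAt.comp q hasFDerivAt_fst).prodMk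
    (hasFDerivAt_fderivApply hF.contDiffAt)).fderiv

theorem IsVariation.isIntegralCurveOn_prolong (hw : IsVariation F a b y w)
    (hy : IsIntegralCurveOn y (fun _ => F) (Icc a b)) :
    IsIntegralCurveOn (fun t => (y t, w t)) (fun _ => prolong F) (Icc a b) :=
  fun t ht => (hy t ht).prodMk (hw t ht)

theorem IsEndMap.prolong [CompleteSpace X] (hF : ContDiff ℝ 1 F) (hab : a ≤ b)
    (hΦ : IsEndMap F a b Φ) : IsEndMap (prolong F) a b (prolong Φ) := by
  intro q hq
  have hy : IsIntegralCurveOn (fun t => (q t).1) (fun _ => F) (Icc a b) := fun t ht => (hq t ht).fst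
  exact Prod.ext (hΦ _ hy) (hΦ.fderiv_apply hF hab hy fun t ht => (hq t ht).snd)

theorem hasDerivWithinAt_coprod {Y : Type*} [NormedAddCommGroup Y] [NormedSpace ℝ Y]
    {P : ℝ → X →L[ℝ] V} {Q : ℝ → Y →L[ℝ] V} {P' : X →L[ℝ] V} {Q' : Y →L[ℝ] V} {s : Set ℝ} {t : ℝ}
    (hP : HasDerivWithinAt P P' s t) (hQ : HasDerivWithinAt Q Q' s t) :
    HasDerivWithinAt (fun u => (P u).coprod (Q u)) (P'.coprod Q') s t :=
  ((ContinuousLinearMap.coprodEquivL ℝ : ((X →L[ℝ] V) × (Y →L[ℝ] V)) ≃L[ℝ] _)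
    |>.toContinuousLinearMap.hasFDerivAt).comp_hasDerivWithinAt t (hP.prodMk hQ)

theorem IsSecondAdjointSolution.isAdjointSolution_prolong (hF : ContDiff ℝ 2 F)
    (hp : IsAdjointSolution F a b y p)
    (hH : IsSecondAdjointSolution F a b y (fun t => curvature F (y t) (p t)) H)
    (hw : IsVariation F a b y w) :
    IsAdjointSolution (prolong F) a b (fun t => (y t, w t))
      (fun t => (H t (w t)).coprod (p t)) := by
  intro t ht
  have hP := hasDerivWithinAt_coprod ((hH t ht).clm_apply (hw t ht)) (hp t ht)
  refine hP.congr_deriv ?_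
  rw [fderiv_prolong hF]
  ext v
  · simp only [neg_add_rev, add_apply, neg_apply, ContinuousLinearMap.coprod_comp_inl,
      curvature_apply, bilinAction_apply, ContinuousLinearMap.neg_comp,
      ContinuousLinearMap.comp_apply, ContinuousLinearMap.inl_apply,
      ContinuousLinearMap.prod_apply, ContinuousLinearMap.coe_fst',
      ContinuousLinearMap.coprod_apply, map_zero, add_zero]
    abel
  · simp

theorem fderivApply_comp_eventuallyEq {f : X → X} {x : X} (hℓ : ContDiff ℝ 1 ℓ)
    (hf : ContDiffAt ℝ 1 f x) (v : X) :
    fderivApply (ℓ ∘ f) =ᶠ[𝓝 (x, v)] fderivApply ℓ ∘ prolong f := by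
  have hev : ∀ᶠ q : X × X in 𝓝 (x, v), ContDiffAt ℝ 1 f q.1 :=
    continuous_fst.continuousAt.eventually (hf.eventually (by simp))
  filter_upwards [hev] with q hq
  exact DFunLike.congr_fun (fderiv_comp q.1 (hℓ.differentiable one_ne_zero _)
    (hq.differentiableAt one_ne_zero)) q.2

/-- For a variation `w`, the pair `(H(w, ·), p)` solves the adjoint equation of the prolonged
equation along `(y, w)`; the second derivative is thus the first-order statement for `Dℓ`. -/
theorem IsSecondAdjointSolution.secondDeriv_comp_eq [CompleteSpace X] (hF : ContDiff ℝ 2 F)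
    (hΦ : IsEndMap F a b Φ) (hab : a ≤ b) (hy : IsIntegralCurveOn y (fun _ => F) (Icc a b))
    (hℓ : ContDiff ℝ 2 ℓ) (hp : IsAdjointSolution F a b y p) (hpb : p b = fderiv ℝ ℓ (y b))
    (hH : IsSecondAdjointSolution F a b y (fun t => curvature F (y t) (p t)) H)
    (hHb : H b = secondDeriv ℓ (y b)) : secondDeriv (ℓ ∘ Φ) (y a) = H a := by
  have hF₁ : ContDiff ℝ 1 F := hF.of_le (by norm_num)
  have hΦ₂ : ContDiffAt ℝ 2 Φ (y a) := hΦ.contDiffAt (n := 2) two_ne_zero hF hab hy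
  ext1 v
  obtain ⟨w, rfl, hw⟩ := exists_isVariation hF₁ hy.continuousOn (left_mem_Icc.2 hab) v
  have hterminal : HasFDerivAt (fderivApply ℓ) ((H b (w b)).coprod (p b)) (y b, w b) := by
    rw [hHb, hpb]
    exact hasFDerivAt_fderivApply (q := (y b, w b)) hℓ.contDiffAt
  have hinitial := (hH.isAdjointSolution_prolong hF hp hw).fderiv_comp_eq (contDiff_prolong hF)
    (hΦ.prolong hF₁ hab) hab (hw.isIntegralCurveOn_prolong hy) hterminal
  rw [← (fderivApply_comp_eventuallyEq (hℓ.of_le (by norm_num)) (hΦ₂.of_le (by norm_num))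
    (w a)).fderiv_eq, (hasFDerivAt_fderivApply (hℓ.contDiffAt.comp (y a) hΦ₂)).fderiv] at hinitial
  simpa using congrArg (fun P => P ∘L ContinuousLinearMap.inl ℝ X X) hinitial

theorem forall_secondDeriv_eq_zero_iff {f : X → V} (hf : ContDiff ℝ 2 f) :
    (∀ x, secondDeriv f x = 0) ↔ ∃ (A : X →L[ℝ] V) (v : V), ∀ x, f x = A x + v := by
  have hflip : ∀ x, secondDeriv f x = 0 ↔ fderiv ℝ (fderiv ℝ f) x = 0 := fun x =>
    (ContinuousLinearMap.flipₗᵢ ℝ X X V).map_eq_zero_iff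
  simp only [hflip]
  constructor
  · intro hzero
    have hDf : Differentiable ℝ (fderiv ℝ f) :=
      (hf.fderiv_right (m := 1) (by norm_num)).differentiable one_ne_zero
    have hconst : ∀ x, fderiv ℝ f x = fderiv ℝ f 0 := fun x =>
      is_const_of_fderiv_eq_zero hDf hzero x 0
    have hsub : ∀ x, HasFDerivAt (fun z => f z - fderiv ℝ f 0 z) (0 : X →L[ℝ] V) x := fun x =>
      ((hf.differentiable two_ne_zero x).hasFDerivAt.sub
        (fderiv ℝ f 0).hasFDerivAt).congr_fderiv (by rw [hconst x, sub_self])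
    refine ⟨fderiv ℝ f 0, f 0, fun x => ?_⟩
    have := is_const_of_fderiv_eq_zero (fun z => (hsub z).differentiableAt)
      (fun z => (hsub z).fderiv) x 0
    rw [map_zero, sub_zero, sub_eq_iff_eq_add] at this
    rw [this, add_comm]
  · rintro ⟨A, v, hA⟩ x
    have hconst : fderiv ℝ f = fun _ => A := by
      rw [funext hA]
      exact funext fun z => (A.hasFDerivAt.add_const v).fderiv
    rw [hconst, fderiv_fun_const]
    rfl

/-- The field `z ↦ q(z - x)² v`, which is stationary to first order at `x`. -/
def squareField (q : X →L[ℝ] ℝ) (x v : X) (z : X) : X :=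
  (q (z - x)) ^ 2 • v

theorem squareField_self (q : X →L[ℝ] ℝ) (x v : X) : squareField q x v x = 0 := by
  simp [squareField]

theorem contDiff_squareField (q : X →L[ℝ] ℝ) (x v : X) {n : WithTop ℕ∞} :
    ContDiff ℝ n (squareField q x v) :=
  ((q.contDiff.comp (contDiff_id.sub contDiff_const)).pow 2).smul contDiff_const

theorem fderiv_squareField (q : X →L[ℝ] ℝ) (x v z : X) :
    fderiv ℝ (squareField q x v) z = (2 * q (z - x)) • q.smulRight v := by
  have hq := q.hasFDerivAt.comp z ((hasFDerivAt_id z).sub_const x)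
  refine ((hq.pow 2).smul_const v).fderiv.trans ?_
  ext u
  simp [mul_assoc, smul_smul]

theorem fderiv_squareField_self (q : X →L[ℝ] ℝ) (x v : X) :
    fderiv ℝ (squareField q x v) x = 0 := by
  simp [fderiv_squareField]

theorem secondDeriv_squareField (q : X →L[ℝ] ℝ) (x v z u w : X) :
    secondDeriv (squareField q x v) z u w = (2 * q u * q w) • v := by
  have hq := ((q.hasFDerivAt.comp z ((hasFDerivAt_id z).sub_const x)).const_mul 2).smul_const
    (q.smulRight v)
  rw [secondDeriv, ContinuousLinearMap.flip_apply, funext (fderiv_squareField q x v)]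
  refine (DFunLike.congr_fun (DFunLike.congr_fun hq.fderiv w) u).trans ?_
  simp only [ContinuousLinearMap.comp_id, ContinuousLinearMap.smulRight_apply, smul_apply,
    smul_eq_mul, smul_smul]
  ring_nf

end Prolongation

section Coordinates

variable {D : ℕ} {V : Type*} [NormedAddCommGroup V] [NormedSpace ℝ V] {F : State D → State D}
  {L f : State D → ℝ} {a b : ℝ} {x : State D} {y : ℝ → State D}

/-- A linear map `p` on the state space as the family `(p e_i)_i`. -/
noncomputable def coordEquiv : (State D →L[ℝ] V) ≃L[ℝ] (Fin D → V) :=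
  ((EuclideanSpace.equiv (Fin D) ℝ).arrowCongr (.refl ℝ V)).trans (.piRing _)

theorem coordEquiv_apply (p : State D →L[ℝ] V) (i : Fin D) :
    coordEquiv p i = p (EuclideanSpace.single i 1) :=
  rfl

/-- A bilinear form `H` on the state space as the matrix `(H e_i e_j)_ij`. -/
noncomputable def bilinCoordEquiv :
    (State D →L[ℝ] State D →L[ℝ] ℝ) ≃L[ℝ] Matrix (Fin D) (Fin D) ℝ :=
  ((ContinuousLinearEquiv.refl ℝ (State D)).arrowCongr coordEquiv).trans coordEquiv

theorem bilinCoordEquiv_apply (H : State D →L[ℝ] State D →L[ℝ] ℝ) (i j : Fin D) :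
    bilinCoordEquiv H i j = H (EuclideanSpace.single i 1) (EuclideanSpace.single j 1) :=
  rfl

theorem sum_coordEquiv_mul (p : State D →L[ℝ] ℝ) (v : State D) :
    ∑ m, coordEquiv p m * v m = p v := by
  conv_rhs => rw [← (EuclideanSpace.basisFun (Fin D) ℝ).sum_repr v]
  simp [coordEquiv_apply, mul_comm]

theorem forall_hasDerivWithinAt_coordEquiv_iff {p : ℝ → State D →L[ℝ] V} {p' : State D →L[ℝ] V}
    {s : Set ℝ} {t : ℝ} :
    (∀ i, HasDerivWithinAt (fun u => coordEquiv (p u) i) (coordEquiv p' i) s t) ↔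
      HasDerivWithinAt p p' s t := by
  rw [← hasDerivWithinAt_pi]
  refine ⟨fun h => ?_, fun h => ?_⟩
  · simpa [Function.comp_def] using
      coordEquiv.symm.toContinuousLinearMap.hasFDerivAt.comp_hasDerivWithinAt t h
  · exact (coordEquiv (V := V)).toContinuousLinearMap.hasFDerivAt.comp_hasDerivWithinAt t h

theorem forall_hasDerivWithinAt_bilinCoordEquiv_iff {H : ℝ → State D →L[ℝ] State D →L[ℝ] ℝ}
    {H' : State D →L[ℝ] State D →L[ℝ] ℝ} {s : Set ℝ} {t : ℝ} :
    (∀ i j, HasDerivWithinAt (fun u => bilinCoordEquiv (H u) i j) (bilinCoordEquiv H' i j) s t) ↔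
      HasDerivWithinAt H H' s t := by
  rw [← forall_hasDerivWithinAt_coordEquiv_iff]
  exact forall_congr' fun i => forall_hasDerivWithinAt_coordEquiv_iff

theorem grad_eq_coordEquiv (f : State D → ℝ) (x : State D) : grad f x = coordEquiv (fderiv ℝ f x) :=
  rfl

theorem hess_eq_bilinCoordEquiv (hf : ContDiffAt ℝ 2 f x) :
    hess f x = bilinCoordEquiv (secondDeriv f x) := by
  ext i j
  have hDf := ((hf.fderiv_right (m := 1) (by norm_num)).differentiableAt one_ne_zero).hasFDerivAt
  have hpartial := hDf.clm_apply (hasFDerivAt_const (EuclideanSpace.single i (1 : ℝ)) x)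
  refine (DFunLike.congr_fun hpartial.fderiv (EuclideanSpace.single j 1)).trans ?_
  simp [bilinCoordEquiv_apply, secondDeriv]

theorem jac_eq (hF : DifferentiableAt ℝ F x) (m i : Fin D) :
    jac F x m i = fderiv ℝ F x (EuclideanSpace.single i 1) m :=
  DFunLike.congr_fun
    ((EuclideanSpace.proj (𝕜 := ℝ) m).hasFDerivAt.comp x hF.hasFDerivAt).fderiv _

theorem jac2_eq (hF : ContDiff ℝ 2 F) (x : State D) (m i j : Fin D) :
    jac2 F x m i j =
      secondDeriv F x (EuclideanSpace.single i 1) (EuclideanSpace.single j 1) m := by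
  have hm : ContDiff ℝ 2 (EuclideanSpace.proj (𝕜 := ℝ) m ∘ F) :=
    (ContinuousLinearMap.contDiff _).comp hF
  exact congrFun₂ ((hess_eq_bilinCoordEquiv hm.contDiffAt).trans
    (congrArg _ (secondDeriv_clm_comp _ hF x))) i j

theorem curvatureTerm_coordEquiv (hF : ContDiff ℝ 2 F) (y : ℝ → State D)
    (p : ℝ → State D →L[ℝ] ℝ) (t : ℝ) (i j : Fin D) :
    curvatureTerm F y (coordEquiv ∘ p) t i j = bilinCoordEquiv (curvature F (y t) (p t)) i j := by
  simp only [curvatureTerm, jac2_eq hF, Function.comp_apply, sum_coordEquiv_mul]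
  rfl

theorem isCostate_coordEquiv_iff (hF : Differentiable ℝ F) {p : ℝ → State D →L[ℝ] ℝ} :
    IsCostate F L a b y (coordEquiv ∘ p) ↔
      p b = fderiv ℝ L (y b) ∧ IsAdjointSolution F a b y p := by
  refine and_congr coordEquiv.injective.eq_iff (forall₂_congr fun t _ => ?_)
  rw [← forall_hasDerivWithinAt_coordEquiv_iff]
  simp only [jac_eq (hF _), Function.comp_apply, sum_coordEquiv_mul]
  rfl

theorem isSecondAdjointSolution_iff (hF : Differentiable ℝ F)
    {H c : ℝ → State D →L[ℝ] State D →L[ℝ] ℝ} :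
    IsSecondAdjointSolution F a b y c H ↔ ∀ t ∈ Icc a b, ∀ i j,
      HasDerivWithinAt (fun s => bilinCoordEquiv (H s) i j)
        (-(∑ m, bilinCoordEquiv (H t) m j * jac F (y t) m i) -
          (∑ m, bilinCoordEquiv (H t) i m * jac F (y t) m j) - bilinCoordEquiv (c t) i j)
        (Icc a b) t := by
  refine forall₂_congr fun t _ => ?_
  rw [← forall_hasDerivWithinAt_bilinCoordEquiv_iff]
  refine forall₂_congr fun i j => ?_
  have hleft := sum_coordEquiv_mul ((H t).flip (EuclideanSpace.single j 1))
    (fderiv ℝ F (y t) (EuclideanSpace.single i 1))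
  have hright := sum_coordEquiv_mul (H t (EuclideanSpace.single i 1))
    (fderiv ℝ F (y t) (EuclideanSpace.single j 1))
  simp only [coordEquiv_apply, ContinuousLinearMap.flip_apply] at hleft hright
  simp only [jac_eq (hF _), bilinCoordEquiv_apply, hleft, hright, neg_apply, add_apply,
    bilinAction_apply]
  rw [neg_add', neg_add']

theorem isBackwardHessian_coordEquiv_iff (hF : ContDiff ℝ 2 F) (hL : ContDiff ℝ 2 L)
    {p : ℝ → State D →L[ℝ] ℝ} {H : ℝ → State D →L[ℝ] State D →L[ℝ] ℝ} :
    IsBackwardHessian F L a b y (coordEquiv ∘ p) (bilinCoordEquiv ∘ H) ↔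
      H b = secondDeriv L (y b) ∧
        IsSecondAdjointSolution F a b y (fun t => curvature F (y t) (p t)) H := by
  simp only [IsBackwardHessian, hess_eq_bilinCoordEquiv hL.contDiffAt, curvatureTerm_coordEquiv hF,
    isSecondAdjointSolution_iff (hF.differentiable two_ne_zero), Function.comp_apply,
    bilinCoordEquiv.injective.eq_iff]

theorem isTruncatedHessian_coordEquiv_iff (hF : Differentiable ℝ F) (hL : ContDiff ℝ 2 L)
    {K : ℝ → State D →L[ℝ] State D →L[ℝ] ℝ} :
    IsTruncatedHessian F L a b y (bilinCoordEquiv ∘ K) ↔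
      K b = secondDeriv L (y b) ∧ IsSecondAdjointSolution F a b y (fun _ => 0) K := by
  simp only [IsTruncatedHessian, hess_eq_bilinCoordEquiv hL.contDiffAt,
    isSecondAdjointSolution_iff hF, Function.comp_apply, bilinCoordEquiv.injective.eq_iff, map_zero,
    Matrix.zero_apply, sub_zero]

end Coordinates

section EndStateLoss

variable {D : ℕ} {F : State D → State D} {L : State D → ℝ} {a b t : ℝ}
  {y : ℝ → State D} {σ : ℝ → Fin D → ℝ} {h k : ℝ → Matrix (Fin D) (Fin D) ℝ}

theorem IsTrajectory.continuousOn (hy : IsTrajectory F a b y) : ContinuousOn y (Icc a b) :=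
  fun t ht => (hy t ht).continuousWithinAt

theorem IsTrajectory.mono_left (hy : IsTrajectory F a b y) (hat : a ≤ t) : IsTrajectory F t b y :=
  IsIntegralCurveOn.mono hy (Icc_subset_Icc_left hat)

theorem IsCostate.mono_left (hσ : IsCostate F L a b y σ) (hat : a ≤ t) : IsCostate F L t b y σ :=
  ⟨hσ.1, fun s hs i => (hσ.2 s ⟨hat.trans hs.1, hs.2⟩ i).mono (Icc_subset_Icc_left hat)⟩

theorem IsBackwardHessian.mono_left (hh : IsBackwardHessian F L a b y σ h) (hat : a ≤ t) :
    IsBackwardHessian F L t b y σ h :=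
  ⟨hh.1, fun s hs i j => (hh.2 s ⟨hat.trans hs.1, hs.2⟩ i j).mono (Icc_subset_Icc_left hat)⟩

theorem IsTruncatedHessian.mono_left (hk : IsTruncatedHessian F L a b y k) (hat : a ≤ t) :
    IsTruncatedHessian F L t b y k :=
  ⟨hk.1, fun s hs i j => (hk.2 s ⟨hat.trans hs.1, hs.2⟩ i j).mono (Icc_subset_Icc_left hat)⟩

theorem exists_isCostate (hF : ContDiff ℝ 1 F) (L : State D → ℝ) (hab : a ≤ b)
    (hy : IsTrajectory F a b y) : ∃ σ, IsCostate F L a b y σ := by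
  obtain ⟨p, hpb, hp⟩ := exists_isAdjointSolution hF hy.continuousOn (right_mem_Icc.2 hab)
    (fderiv ℝ L (y b))
  exact ⟨_, (isCostate_coordEquiv_iff (hF.differentiable one_ne_zero)).2 ⟨hpb, hp⟩⟩

theorem exists_isBackwardHessian (hF : ContDiff ℝ 2 F) (hL : ContDiff ℝ 2 L) (hab : a ≤ b)
    (hy : IsTrajectory F a b y) (hσ : IsCostate F L a b y σ) :
    ∃ h, IsBackwardHessian F L a b y σ h := by
  obtain ⟨p, rfl⟩ := coordEquiv.surjective.comp_left σ
  obtain ⟨-, hp⟩ := (isCostate_coordEquiv_iff (hF.differentiable two_ne_zero)).1 hσ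
  have hcurv := continuousOn_curvature hF hy.continuousOn
    (fun t ht => (hp t ht).continuousWithinAt)
  obtain ⟨H, hHb, hH⟩ := exists_isSecondAdjointSolution (hF.of_le one_le_two) hy.continuousOn hcurv
    (right_mem_Icc.2 hab) (secondDeriv L (y b))
  exact ⟨_, (isBackwardHessian_coordEquiv_iff hF hL).2 ⟨hHb, hH⟩⟩

theorem exists_isCostate_isBackwardHessian (hF : ContDiff ℝ 2 F) (hL : ContDiff ℝ 2 L)
    (hab : a ≤ b) (hy : IsTrajectory F a b y) :
    ∃ σ h, IsCostate F L a b y σ ∧ IsBackwardHessian F L a b y σ h := by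
  obtain ⟨σ, hσ⟩ := exists_isCostate (hF.of_le one_le_two) L hab hy
  obtain ⟨h, hh⟩ := exists_isBackwardHessian hF hL hab hy hσ
  exact ⟨σ, h, hσ, hh⟩

theorem exists_isTruncatedHessian (hF : ContDiff ℝ 1 F) (hL : ContDiff ℝ 2 L) (hab : a ≤ b)
    (hy : IsTrajectory F a b y) : ∃ k, IsTruncatedHessian F L a b y k := by
  obtain ⟨K, hKb, hK⟩ := exists_isSecondAdjointSolution hF hy.continuousOn continuousOn_const
    (right_mem_Icc.2 hab) (secondDeriv L (y b))
  exact ⟨_, (isTruncatedHessian_coordEquiv_iff (hF.differentiable one_ne_zero) hL).2 ⟨hKb, hK⟩⟩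

theorem isEndMap_flowMap (hF : ContDiff ℝ 1 F) (hab : a ≤ b) : IsEndMap F a b (flowMap F a b) := by
  intro z hz
  have hex : ∃ y, IsTrajectory F a b y ∧ y a = z a := ⟨z, hz, rfl⟩
  rw [flowMap, dif_pos hex]
  exact isIntegralCurveOn_Icc_eqOn_of_left_eq hF hex.choose_spec.1 hz hex.choose_spec.2
    (right_mem_Icc.2 hab)

theorem contDiffAt_lossFrom {n : ℕ∞} (hn : n ≠ 0) (hF : ContDiff ℝ n F) (hL : ContDiff ℝ n L)
    (hab : a ≤ b) (hy : IsTrajectory F a b y) : ContDiffAt ℝ n (lossFrom F L a b) (y a) :=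
  have hF₁ : ContDiff ℝ 1 F := hF.of_le (by exact_mod_cast Order.one_le_iff_ne_zero.2 hn)
  hL.contDiffAt.comp (y a) ((isEndMap_flowMap hF₁ hab).contDiffAt hn hF hab hy)

theorem IsCostate.grad_lossFrom (hF : ContDiff ℝ 1 F) (hL : Differentiable ℝ L)
    (hy : IsTrajectory F a b y) (hσ : IsCostate F L a b y σ) (ht : t ∈ Icc a b) :
    grad (lossFrom F L t b) (y t) = σ t := by
  obtain ⟨p, rfl⟩ := coordEquiv.surjective.comp_left σ
  obtain ⟨hpb, hp⟩ := (isCostate_coordEquiv_iff (hF.differentiable one_ne_zero)).1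
    (hσ.mono_left ht.1)
  exact congrArg coordEquiv (hp.fderiv_comp_eq hF (isEndMap_flowMap hF ht.2) ht.2
    (hy.mono_left ht.1) (hpb ▸ (hL (y b)).hasFDerivAt))

theorem IsBackwardHessian.hess_lossFrom (hF : ContDiff ℝ 2 F) (hL : ContDiff ℝ 2 L)
    (hy : IsTrajectory F a b y) (hσ : IsCostate F L a b y σ)
    (hh : IsBackwardHessian F L a b y σ h) (ht : t ∈ Icc a b) :
    hess (lossFrom F L t b) (y t) = h t := by
  obtain ⟨p, rfl⟩ := coordEquiv.surjective.comp_left σ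
  obtain ⟨H, rfl⟩ := bilinCoordEquiv.surjective.comp_left h
  obtain ⟨hpb, hp⟩ := (isCostate_coordEquiv_iff (hF.differentiable two_ne_zero)).1
    (hσ.mono_left ht.1)
  obtain ⟨hHb, hH⟩ := (isBackwardHessian_coordEquiv_iff hF hL).1 (hh.mono_left ht.1)
  have hyt := hy.mono_left ht.1
  rw [hess_eq_bilinCoordEquiv (contDiffAt_lossFrom (n := 2) two_ne_zero hF hL ht.2 hyt)]
  exact congrArg bilinCoordEquiv (hH.secondDeriv_comp_eq hF
    (isEndMap_flowMap (hF.of_le one_le_two) ht.2) ht.2 hyt hL hp hpb hHb)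

theorem IsTruncatedHessian.forall_eq_hess_lossFrom_iff (hF : ContDiff ℝ 2 F) (hL : ContDiff ℝ 2 L)
    (hab : a < b) (hy : IsTrajectory F a b y) (hσ : IsCostate F L a b y σ)
    (hk : IsTruncatedHessian F L a b y k) :
    (∀ t ∈ Icc a b, k t = hess (lossFrom F L t b) (y t)) ↔ CurvatureTermVanishes F a b y σ := by
  constructor
  · intro heq t ht i j
    obtain ⟨h, hh⟩ := exists_isBackwardHessian hF hL hab.le hy hσ
    have hkh : EqOn k h (Icc a b) := fun s hs => (heq s hs).trans (hh.hess_lossFrom hF hL hy hσ hs)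
    have hderiv := (hh.2 t ht i j).congr (fun s hs => congrFun₂ (hkh hs) i j)
      (congrFun₂ (hkh ht) i j)
    rw [← hkh ht] at hderiv
    exact sub_eq_self.1 ((uniqueDiffOn_Icc hab t ht).eq_deriv _ hderiv (hk.2 t ht i j))
  · intro hvanish t ht
    have hk' : IsBackwardHessian F L a b y σ k :=
      ⟨hk.1, fun s hs i j => by simpa only [hvanish s hs i j, sub_zero] using hk.2 s hs i j⟩
    exact (hk'.hess_lossFrom hF hL hy hσ ht).symm

theorem IsTruncatedHessian.exists_ne_hess_lossFrom (hF : ContDiff ℝ 2 F) (hL : ContDiff ℝ 2 L)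
    (hab : a < b) (hy : IsTrajectory F a b y) (hσ : IsCostate F L a b y σ)
    (hk : IsTruncatedHessian F L a b y k) (hvanish : ¬ CurvatureTermVanishes F a b y σ) :
    ∃ t ∈ Ico a b, k t ≠ hess (lossFrom F L t b) (y t) ∧ ¬ CurvatureTermVanishes F t b y σ := by
  rw [← hk.forall_eq_hess_lossFrom_iff hF hL hab hy hσ] at hvanish
  push Not at hvanish
  obtain ⟨t, ht, hne⟩ := hvanish
  obtain rfl | htb := ht.2.eq_or_lt
  · obtain ⟨h, hh⟩ := exists_isBackwardHessian hF hL hab.le hy hσ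
    exact absurd (hk.1.trans (hh.1.symm.trans (hh.hess_lossFrom hF hL hy hσ ht).symm)) hne
  · refine ⟨t, ⟨ht.1, htb⟩, hne, fun hvanish => hne ?_⟩
    exact ((hk.mono_left ht.1).forall_eq_hess_lossFrom_iff hF hL htb (hy.mono_left ht.1)
      (hσ.mono_left ht.1)).2 hvanish t (left_mem_Icc.2 ht.2)

end EndStateLoss

section Vanishing

variable {D : ℕ} {F : State D → State D} {L : State D → ℝ} {a b t : ℝ} {x : State D}
  {y : ℝ → State D} {σ : ℝ → Fin D → ℝ} {p : ℝ → State D →L[ℝ] ℝ}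

theorem curvatureTermVanishes_coordEquiv_iff (hF : ContDiff ℝ 2 F) :
    CurvatureTermVanishes F a b y (coordEquiv ∘ p) ↔
      ∀ t ∈ Icc a b, curvature F (y t) (p t) = 0 := by
  refine forall₂_congr fun t _ => ?_
  simp only [curvatureTerm_coordEquiv hF]
  rw [← bilinCoordEquiv.map_eq_zero_iff, ← Matrix.ext_iff]
  rfl

theorem secondDeriv_eq_zero_iff_jac2 (hF : ContDiff ℝ 2 F) :
    secondDeriv F x = 0 ↔ ∀ m i j, jac2 F x m i j = 0 := by
  simp only [jac2_eq hF]
  refine ⟨fun hzero m i j => by simp [hzero], fun hzero => ?_⟩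
  exact coordEquiv.injective <| funext fun i => coordEquiv.injective <| funext fun j =>
    PiLp.ext fun m => hzero m i j

theorem isAffineField_iff (hF : ContDiff ℝ 2 F) :
    IsAffineField F ↔ ∀ x, secondDeriv F x = 0 :=
  Iff.trans ⟨fun ⟨A, c, hA⟩ => ⟨A.toContinuousLinearMap, c, hA⟩, fun ⟨A, c, hA⟩ => ⟨A, c, hA⟩⟩
    (forall_secondDeriv_eq_zero_iff hF).symm

theorem IsAffineField.curvatureTermVanishes (hF : ContDiff ℝ 2 F) (hAffine : IsAffineField F)
    (a b : ℝ) (y : ℝ → State D) (σ : ℝ → Fin D → ℝ) : CurvatureTermVanishes F a b y σ :=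
  fun t _ i j => Finset.sum_eq_zero fun m _ => by
    rw [(secondDeriv_eq_zero_iff_jac2 hF).1 ((isAffineField_iff hF).1 hAffine (y t)) m i j,
      mul_zero]

theorem IsCostate.eq_comp_fderiv_flowMap (hF : ContDiff ℝ 1 F) (hy : IsTrajectory F a b y)
    (hp : IsCostate F L a b y (coordEquiv ∘ p)) (ht : t ∈ Icc a b) :
    p t = fderiv ℝ L (y b) ∘L fderiv ℝ (flowMap F t b) (y t) := by
  obtain ⟨hpb, hp⟩ := (isCostate_coordEquiv_iff (hF.differentiable one_ne_zero)).1
    (hp.mono_left ht.1)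
  rw [← hpb]
  exact hp.eq_comp_fderiv hF (isEndMap_flowMap hF ht.2) ht.2 (hy.mono_left ht.1)

theorem IsCostate.eq_zero (hF : ContDiff ℝ 1 F) (hy : IsTrajectory F a b y)
    (hσ : IsCostate F L a b y σ) (hcrit : grad L (y b) = 0) (ht : t ∈ Icc a b) : σ t = 0 := by
  obtain ⟨p, rfl⟩ := coordEquiv.surjective.comp_left σ
  have hfderiv : fderiv ℝ L (y b) = 0 := coordEquiv.map_eq_zero_iff.1 hcrit
  change coordEquiv (p t) = 0
  rw [hσ.eq_comp_fderiv_flowMap hF hy ht, hfderiv, ContinuousLinearMap.zero_comp, map_zero]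

/-- The terminal gradients `g` along `y` for which the curvature term vanishes: the costate with
terminal value `g` is `g ∘ DΦ_t(y(t))` at time `t`. -/
noncomputable def vanishingSubspace (F : State D → State D) (a b : ℝ) (y : ℝ → State D) :
    Submodule ℝ (Fin D → ℝ) where
  carrier := {g | ∀ t ∈ Icc a b,
    curvature F (y t) (coordEquiv.symm g ∘L fderiv ℝ (flowMap F t b) (y t)) = 0}
  zero_mem' t _ := by ext; simp [curvature_apply]
  add_mem' hg hg' t ht := by
    ext u v
    have hsum := congrArg₂ (· + ·) (hg t ht) (hg' t ht)
    simpa [curvature_apply] using DFunLike.congr_fun (DFunLike.congr_fun hsum u) v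
  smul_mem' r g hg t ht := by
    ext u v
    have hsmul := DFunLike.congr_fun (DFunLike.congr_fun (hg t ht) u) v
    simp only [curvature_apply, ContinuousLinearMap.comp_apply, zero_apply] at hsmul ⊢
    simp [hsmul]

theorem coordEquiv_mem_vanishingSubspace (ℓ : State D →L[ℝ] ℝ) :
    coordEquiv ℓ ∈ vanishingSubspace F a b y ↔
      ∀ t ∈ Icc a b, curvature F (y t) (ℓ ∘L fderiv ℝ (flowMap F t b) (y t)) = 0 :=
  forall₂_congr fun t _ => by rw [ContinuousLinearEquiv.symm_apply_apply]

theorem IsCostate.curvatureTermVanishes_iff (hF : ContDiff ℝ 2 F) (hy : IsTrajectory F a b y)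
    (hσ : IsCostate F L a b y σ) :
    CurvatureTermVanishes F a b y σ ↔ grad L (y b) ∈ vanishingSubspace F a b y := by
  obtain ⟨p, rfl⟩ := coordEquiv.surjective.comp_left σ
  rw [curvatureTermVanishes_coordEquiv_iff hF, grad_eq_coordEquiv,
    coordEquiv_mem_vanishingSubspace]
  exact forall₂_congr fun t ht => by
    rw [hσ.eq_comp_fderiv_flowMap (hF.of_le one_le_two) hy ht]

theorem IsCostate.curvatureTermVanishes_of_grad_eq_zero (hF : ContDiff ℝ 2 F)
    (hy : IsTrajectory F a b y) (hσ : IsCostate F L a b y σ) (hcrit : grad L (y b) = 0) :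
    CurvatureTermVanishes F a b y σ :=
  (hσ.curvatureTermVanishes_iff hF hy).2 (hcrit ▸ zero_mem _)

theorem vanishingSubspace_eq_top_iff (hF : ContDiff ℝ 2 F) (hy : IsTrajectory F a b y) :
    vanishingSubspace F a b y = ⊤ ↔ ∀ t ∈ Icc a b, secondDeriv F (y t) = 0 := by
  have hF₁ : ContDiff ℝ 1 F := hF.of_le one_le_two
  constructor
  · intro htop t ht
    ext u v m
    -- Every covector at time `t`, here `e_m`, is transported to some terminal covector `p b`.
    obtain ⟨p, hpt, hp⟩ := exists_isAdjointSolution hF₁ (hy.mono_left ht.1).continuousOn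
      (left_mem_Icc.2 ht.2) (EuclideanSpace.proj m : State D →L[ℝ] ℝ)
    have hmem := (coordEquiv_mem_vanishingSubspace (p b)).1 (htop ▸ Submodule.mem_top) t ht
    rw [← hp.eq_comp_fderiv hF₁ (isEndMap_flowMap hF₁ ht.2) ht.2 (hy.mono_left ht.1), hpt] at hmem
    exact DFunLike.congr_fun (DFunLike.congr_fun hmem u) v
  · refine fun hzero => eq_top_iff.2 fun g _ t ht => ?_
    rw [curvature, hzero t ht, ContinuousLinearMap.comp_zero]

theorem exists_isTrajectory (hF : ContDiff ℝ 1 F) (x : State D) :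
    ∃ b > 0, ∃ y, y 0 = x ∧ IsTrajectory F 0 b y := by
  obtain ⟨r, hr, ε, hε, hsol⟩ :=
    hF.contDiffAt.exists_forall_mem_closedBall_exists_eq_forall_mem_Ioo_hasDerivAt (x₀ := x) 0
  obtain ⟨y, hy₀, hy⟩ := hsol x (Metric.mem_closedBall_self hr.le)
  refine ⟨ε / 2, half_pos hε, y, hy₀, fun t ht => (hy t ⟨?_, ?_⟩).hasDerivWithinAt⟩
  · linarith [ht.1]
  · linarith [ht.2]

theorem exists_vanishingSubspace_ne_top (hF : ContDiff ℝ 2 F) (hAffine : ¬ IsAffineField F) :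
    ∃ b > 0, ∃ y, IsTrajectory F 0 b y ∧ vanishingSubspace F 0 b y ≠ ⊤ := by
  rw [isAffineField_iff hF] at hAffine
  push Not at hAffine
  obtain ⟨x, hx⟩ := hAffine
  obtain ⟨b, hb, y, rfl, hy⟩ := exists_isTrajectory (hF.of_le one_le_two) x
  exact ⟨b, hb, y, hy, fun htop =>
    hx ((vanishingSubspace_eq_top_iff hF hy).1 htop 0 (left_mem_Icc.2 hb.le))⟩

theorem exists_loss_truncatedHessian_ne_hess_lossFrom (hF : ContDiff ℝ 2 F)
    (hAffine : ¬ IsAffineField F) :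
    ∃ (a b : ℝ) (y : ℝ → State D) (L : State D → ℝ) (σ : ℝ → Fin D → ℝ)
      (k : ℝ → Matrix (Fin D) (Fin D) ℝ),
      a < b ∧ IsTrajectory F a b y ∧ ContDiff ℝ ∞ L ∧ IsCostate F L a b y σ ∧
      IsTruncatedHessian F L a b y k ∧ ¬ CurvatureTermVanishes F a b y σ ∧
      k a ≠ hess (lossFrom F L a b) (y a) := by
  have hF₁ : ContDiff ℝ 1 F := hF.of_le one_le_two
  obtain ⟨b, hb, y, hy, hW⟩ := exists_vanishingSubspace_ne_top hF hAffine
  obtain ⟨g, hg⟩ := not_forall.1 (mt Submodule.eq_top_iff'.2 hW)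
  obtain ⟨ℓ, rfl⟩ := coordEquiv.surjective g
  obtain ⟨σ, hσ⟩ := exists_isCostate hF₁ ℓ hb.le hy
  obtain ⟨k, hk⟩ := exists_isTruncatedHessian hF₁ ℓ.contDiff hb.le hy
  have hvanish : ¬ CurvatureTermVanishes F 0 b y σ := by
    rwa [hσ.curvatureTermVanishes_iff hF hy, grad_eq_coordEquiv, ℓ.fderiv]
  obtain ⟨t, ht, hne, hvanish⟩ := hk.exists_ne_hess_lossFrom hF ℓ.contDiff hb hy hσ hvanish
  exact ⟨t, b, y, ℓ, σ, k, ht.2, hy.mono_left ht.1, ℓ.contDiff, hσ.mono_left ht.1,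
    hk.mono_left ht.1, hvanish, hne⟩

end Vanishing

section Stationary

variable {D : ℕ} {F : State D → State D} {L : State D → ℝ} {a b : ℝ} {x : State D}

theorem isTrajectory_const (hx : F x = 0) (a b : ℝ) : IsTrajectory F a b (fun _ => x) :=
  fun t _ => (hasDerivWithinAt_const t _ x).congr_deriv hx.symm

theorem isCostate_const (hx : ∀ m i, jac F x m i = 0) (L : State D → ℝ) (a b : ℝ) :
    IsCostate F L a b (fun _ => x) (fun _ => grad L x) :=
  ⟨rfl, fun t _ i => by simpa [hx] using hasDerivWithinAt_const t (Icc a b) (grad L x i)⟩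

theorem isTruncatedHessian_const (hx : ∀ m i, jac F x m i = 0) (L : State D → ℝ) (a b : ℝ) :
    IsTruncatedHessian F L a b (fun _ => x) (fun _ => hess L x) :=
  ⟨rfl, fun t _ i j => by simpa [hx] using hasDerivWithinAt_const t (Icc a b) (hess L x i j)⟩

theorem isBackwardHessian_const (hx : ∀ m i, jac F x m i = 0) (L : State D → ℝ) (a b : ℝ) :
    IsBackwardHessian F L a b (fun _ => x) (fun _ => grad L x)
      (fun t => hess L x + (b - t) • Matrix.of fun i j => ∑ m, grad L x m * jac2 F x m i j) := by
  refine ⟨by simp, fun t _ i j => ?_⟩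
  simpa [hx, curvatureTerm] using ((((hasDerivAt_id t).const_sub b).mul_const
    (∑ m, grad L x m * jac2 F x m i j)).const_add (hess L x i j)).hasDerivWithinAt (s := Icc a b)

theorem hess_lossFrom_const (hF : ContDiff ℝ 2 F) (hL : ContDiff ℝ 2 L) (hab : a ≤ b)
    (hx : F x = 0) (hjac : ∀ m i, jac F x m i = 0) :
    hess (lossFrom F L a b) x =
      hess L x + (b - a) • Matrix.of fun i j => ∑ m, grad L x m * jac2 F x m i j :=
  (isBackwardHessian_const hjac L a b).hess_lossFrom hF hL (isTrajectory_const hx a b)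
    (isCostate_const hjac L a b) (left_mem_Icc.2 hab)

theorem jac_squareField_self (m : Fin D) (x v : State D) (l i : Fin D) :
    jac (squareField (EuclideanSpace.proj m) x v) x l i = 0 := by
  rw [jac_eq ((contDiff_squareField (n := 1) _ x v).differentiable one_ne_zero x),
    fderiv_squareField_self]
  rfl

theorem sum_mul_jac2_squareField (m : Fin D) (x : State D) (g : Fin D → ℝ) :
    ∑ l, g l * jac2 (squareField (EuclideanSpace.proj m) x (EuclideanSpace.single m 1)) x l m m =
      2 * g m := by
  simp [jac2_eq (contDiff_squareField _ x _), secondDeriv_squareField, mul_comm]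

theorem exists_field_truncatedHessian_ne_hess_lossFrom (hL : ContDiff ℝ 2 L) (hx : grad L x ≠ 0)
    (hab : a < b) :
    ∃ (F : State D → State D) (y : ℝ → State D) (σ : ℝ → Fin D → ℝ)
      (k : ℝ → Matrix (Fin D) (Fin D) ℝ),
      ContDiff ℝ ∞ F ∧ IsTrajectory F a b y ∧ y b = x ∧ IsCostate F L a b y σ ∧
      IsTruncatedHessian F L a b y k ∧ ¬ CurvatureTermVanishes F a b y σ ∧
      k a ≠ hess (lossFrom F L a b) (y a) := by
  obtain ⟨m, hm⟩ := Function.ne_iff.1 hx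
  have hgrad : 2 * grad L x m ≠ 0 := mul_ne_zero two_ne_zero hm
  have hF := squareField_self (EuclideanSpace.proj m) x (EuclideanSpace.single m 1)
  have hjac := jac_squareField_self m x (EuclideanSpace.single m 1)
  refine ⟨_, _, _, _, contDiff_squareField _ _ _, isTrajectory_const hF a b, rfl,
    isCostate_const hjac L a b, isTruncatedHessian_const hjac L a b, fun hvanish => hgrad ?_,
    fun heq => hgrad ?_⟩
  · rw [← sum_mul_jac2_squareField m x]
    exact hvanish a (left_mem_Icc.2 hab.le) m m
  · rw [hess_lossFrom_const (contDiff_squareField _ _ _) hL hab.le hF hjac, left_eq_add,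
      smul_eq_zero_iff_right (sub_pos.2 hab).ne'] at heq
    exact (sum_mul_jac2_squareField m x _).symm.trans (congrFun₂ heq m m)

end Stationary

theorem mainTheorem1_general (D : ℕ) {n : WithTop ℕ∞} (hn : 2 ≤ n) :
    (∀ (F : State D → State D) (L : State D → ℝ), ContDiff ℝ n F → ContDiff ℝ n L →
      ∀ (tS tE : ℝ), tS < tE → ∀ y : ℝ → State D, IsTrajectory F tS tE y →
        (∃ (σ : ℝ → Fin D → ℝ) (h : ℝ → Matrix (Fin D) (Fin D) ℝ),
          IsCostate F L tS tE y σ ∧ IsBackwardHessian F L tS tE y σ h) ∧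
        (∀ t ∈ Icc tS tE,
          (∀ᶠ x in 𝓝 (y t), ∃ z : ℝ → State D, IsTrajectory F t tE z ∧ z t = x) ∧
          (∀ z : ℝ → State D, IsTrajectory F t tE z → flowMap F t tE (z t) = z tE) ∧
          ContDiffAt ℝ 2 (lossFrom F L t tE) (y t)) ∧
        (∀ (σ : ℝ → Fin D → ℝ) (h : ℝ → Matrix (Fin D) (Fin D) ℝ),
          IsCostate F L tS tE y σ → IsBackwardHessian F L tS tE y σ h →
          ∀ t ∈ Icc tS tE,
            grad (lossFrom F L t tE) (y t) = σ t ∧ hess (lossFrom F L t tE) (y t) = h t)) ∧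
    (∀ (F : State D → State D) (L : State D → ℝ), ContDiff ℝ n F → ContDiff ℝ n L →
      ∀ (tS tE : ℝ), tS < tE → ∀ y : ℝ → State D, IsTrajectory F tS tE y →
        (∃ k : ℝ → Matrix (Fin D) (Fin D) ℝ, IsTruncatedHessian F L tS tE y k) ∧
        ∀ (σ : ℝ → Fin D → ℝ) (k : ℝ → Matrix (Fin D) (Fin D) ℝ),
          IsCostate F L tS tE y σ → IsTruncatedHessian F L tS tE y k →
          ((∀ t ∈ Icc tS tE, k t = hess (lossFrom F L t tE) (y t)) ↔
            CurvatureTermVanishes F tS tE y σ)) ∧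
    (∀ (F : State D → State D) (L : State D → ℝ), ContDiff ℝ n F → ContDiff ℝ n L →
      ∀ (tS tE : ℝ), tS < tE → ∀ y : ℝ → State D, IsTrajectory F tS tE y →
        ∀ σ : ℝ → Fin D → ℝ, IsCostate F L tS tE y σ →
          (IsAffineField F → CurvatureTermVanishes F tS tE y σ) ∧
          (grad L (y tE) = 0 →
            (∀ t ∈ Icc tS tE, σ t = 0) ∧ CurvatureTermVanishes F tS tE y σ)) ∧
    (∀ F : State D → State D, ContDiff ℝ n F →
      ∀ (tS tE : ℝ), tS < tE → ∀ y : ℝ → State D, IsTrajectory F tS tE y →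
        ∃ W : Submodule ℝ (Fin D → ℝ),
          (∀ L : State D → ℝ, ContDiff ℝ n L → ∀ σ : ℝ → Fin D → ℝ,
            IsCostate F L tS tE y σ →
            (CurvatureTermVanishes F tS tE y σ ↔ grad L (y tE) ∈ W)) ∧
          (W = ⊤ ↔ ∀ t ∈ Icc tS tE, ∀ m i j, jac2 F (y t) m i j = 0)) ∧
    (∀ F : State D → State D, ContDiff ℝ n F → ¬ IsAffineField F →
      ∃ (tS tE : ℝ) (y : ℝ → State D) (L : State D → ℝ) (σ : ℝ → Fin D → ℝ)
        (k : ℝ → Matrix (Fin D) (Fin D) ℝ),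
        tS < tE ∧ IsTrajectory F tS tE y ∧ ContDiff ℝ ∞ L ∧
        IsCostate F L tS tE y σ ∧ IsTruncatedHessian F L tS tE y k ∧
        ¬ CurvatureTermVanishes F tS tE y σ ∧
        k tS ≠ hess (lossFrom F L tS tE) (y tS)) ∧
    (∀ L : State D → ℝ, ContDiff ℝ n L → ∀ yE : State D, grad L yE ≠ 0 →
      ∀ (tS tE : ℝ), tS < tE →
      ∃ (F : State D → State D) (y : ℝ → State D) (σ : ℝ → Fin D → ℝ)
        (k : ℝ → Matrix (Fin D) (Fin D) ℝ),
        ContDiff ℝ ∞ F ∧ IsTrajectory F tS tE y ∧ y tE = yE ∧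
        IsCostate F L tS tE y σ ∧ IsTruncatedHessian F L tS tE y k ∧
        ¬ CurvatureTermVanishes F tS tE y σ ∧
        k tS ≠ hess (lossFrom F L tS tE) (y tS)) := by
  have hn₁ : 1 ≤ n := one_le_two.trans hn
  refine ⟨fun F L hF hL a b hab y hy => ⟨?_, fun t ht => ⟨?_, ?_, ?_⟩, fun σ h hσ hh t ht => ?_⟩,
    fun F L hF hL a b hab y hy => ⟨?_, fun σ k hσ hk => ?_⟩,
    fun F L hF _ a b _ y hy σ hσ => ⟨fun hAffine => ?_, fun hcrit => ⟨fun t ht => ?_, ?_⟩⟩,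
    fun F hF a b _ y hy => ⟨vanishingSubspace F a b y, fun L _ σ hσ => ?_, ?_⟩,
    fun F hF hAffine => ?_, fun L hL x hx a b hab => ?_⟩
  · exact exists_isCostate_isBackwardHessian (hF.of_le hn) (hL.of_le hn) hab.le hy
  · exact eventually_exists_isIntegralCurveOn (hF.of_le hn₁) ht.2 (hy.mono_left ht.1)
  · exact isEndMap_flowMap (hF.of_le hn₁) ht.2
  · exact contDiffAt_lossFrom (n := 2) two_ne_zero (hF.of_le hn) (hL.of_le hn) ht.2
      (hy.mono_left ht.1)
  · exact ⟨hσ.grad_lossFrom (hF.of_le hn₁) ((hL.of_le hn₁).differentiable one_ne_zero) hy ht,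
      hh.hess_lossFrom (hF.of_le hn) (hL.of_le hn) hy hσ ht⟩
  · exact exists_isTruncatedHessian (hF.of_le hn₁) (hL.of_le hn) hab.le hy
  · exact hk.forall_eq_hess_lossFrom_iff (hF.of_le hn) (hL.of_le hn) hab hy hσ
  · exact hAffine.curvatureTermVanishes (hF.of_le hn) a b y σ
  · exact hσ.eq_zero (hF.of_le hn₁) hy hcrit ht
  · exact hσ.curvatureTermVanishes_of_grad_eq_zero (hF.of_le hn) hy hcrit
  · exact hσ.curvatureTermVanishes_iff (hF.of_le hn) hy
  · simp only [vanishingSubspace_eq_top_iff (hF.of_le hn) hy,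
      secondDeriv_eq_zero_iff_jac2 (hF.of_le hn)]
  · exact exists_loss_truncatedHessian_ne_hess_lossFrom (hF.of_le hn) hAffine
  · exact exists_field_truncatedHessian_ne_hess_lossFrom (hL.of_le hn) hx hab

theorem mainTheorem1 (D : ℕ) :
    -- The backward system is solvable and gives the gradient and the Hessian of the end-state
    -- loss as a function of the state at time `t`, for every `t` in `[tS, tE]`.
    (∀ (F : State D → State D) (L : State D → ℝ), ContDiff ℝ ∞ F → ContDiff ℝ ∞ L →
      ∀ (tS tE : ℝ), tS < tE → ∀ y : ℝ → State D, IsTrajectory F tS tE y →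
        (∃ (σ : ℝ → Fin D → ℝ) (h : ℝ → Matrix (Fin D) (Fin D) ℝ),
          IsCostate F L tS tE y σ ∧ IsBackwardHessian F L tS tE y σ h) ∧
        (∀ t ∈ Icc tS tE,
          (∀ᶠ x in 𝓝 (y t), ∃ z : ℝ → State D, IsTrajectory F t tE z ∧ z t = x) ∧
          (∀ z : ℝ → State D, IsTrajectory F t tE z → flowMap F t tE (z t) = z tE) ∧
          ContDiffAt ℝ 2 (lossFrom F L t tE) (y t)) ∧
        (∀ (σ : ℝ → Fin D → ℝ) (h : ℝ → Matrix (Fin D) (Fin D) ℝ),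
          IsCostate F L tS tE y σ → IsBackwardHessian F L tS tE y σ h →
          ∀ t ∈ Icc tS tE,
            grad (lossFrom F L t tE) (y t) = σ t ∧ hess (lossFrom F L t tE) (y t) = h t)) ∧
    -- The truncated equation is solvable; it gives the Hessian at all times if and only if the
    -- curvature term vanishes along the trajectory.
    (∀ (F : State D → State D) (L : State D → ℝ), ContDiff ℝ ∞ F → ContDiff ℝ ∞ L →
      ∀ (tS tE : ℝ), tS < tE → ∀ y : ℝ → State D, IsTrajectory F tS tE y →
        (∃ k : ℝ → Matrix (Fin D) (Fin D) ℝ, IsTruncatedHessian F L tS tE y k) ∧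
        ∀ (σ : ℝ → Fin D → ℝ) (k : ℝ → Matrix (Fin D) (Fin D) ℝ),
          IsCostate F L tS tE y σ → IsTruncatedHessian F L tS tE y k →
          ((∀ t ∈ Icc tS tE, k t = hess (lossFrom F L t tE) (y t)) ↔
            CurvatureTermVanishes F tS tE y σ)) ∧
    -- The term vanishes if `F` is affine, and if the end point is critical (then `σ = 0`).
    (∀ (F : State D → State D) (L : State D → ℝ), ContDiff ℝ ∞ F → ContDiff ℝ ∞ L →
      ∀ (tS tE : ℝ), tS < tE → ∀ y : ℝ → State D, IsTrajectory F tS tE y →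
        ∀ σ : ℝ → Fin D → ℝ, IsCostate F L tS tE y σ →
          (IsAffineField F → CurvatureTermVanishes F tS tE y σ) ∧
          (grad L (y tE) = 0 →
            (∀ t ∈ Icc tS tE, σ t = 0) ∧ CurvatureTermVanishes F tS tE y σ)) ∧
    -- Along a given trajectory, the term vanishes exactly for terminal gradients in a linear
    -- subspace, which is proper unless the second derivatives of `F` vanish on the trajectory.
    (∀ F : State D → State D, ContDiff ℝ ∞ F →
      ∀ (tS tE : ℝ), tS < tE → ∀ y : ℝ → State D, IsTrajectory F tS tE y →
        ∃ W : Submodule ℝ (Fin D → ℝ),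
          (∀ L : State D → ℝ, ContDiff ℝ ∞ L → ∀ σ : ℝ → Fin D → ℝ,
            IsCostate F L tS tE y σ →
            (CurvatureTermVanishes F tS tE y σ ↔ grad L (y tE) ∈ W)) ∧
          (W = ⊤ ↔ ∀ t ∈ Icc tS tE, ∀ m i j, jac2 F (y t) m i j = 0)) ∧
    -- No velocity field other than the affine ones makes the term vanish for all losses and
    -- trajectories.
    (∀ F : State D → State D, ContDiff ℝ ∞ F → ¬ IsAffineField F →
      ∃ (tS tE : ℝ) (y : ℝ → State D) (L : State D → ℝ) (σ : ℝ → Fin D → ℝ)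
        (k : ℝ → Matrix (Fin D) (Fin D) ℝ),
        tS < tE ∧ IsTrajectory F tS tE y ∧ ContDiff ℝ ∞ L ∧
        IsCostate F L tS tE y σ ∧ IsTruncatedHessian F L tS tE y k ∧
        ¬ CurvatureTermVanishes F tS tE y σ ∧
        k tS ≠ hess (lossFrom F L tS tE) (y tS)) ∧
    -- No end point other than a critical one makes the term vanish for all velocity fields.
    (∀ L : State D → ℝ, ContDiff ℝ ∞ L → ∀ yE : State D, grad L yE ≠ 0 →
      ∀ (tS tE : ℝ), tS < tE →
      ∃ (F : State D → State D) (y : ℝ → State D) (σ : ℝ → Fin D → ℝ)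
        (k : ℝ → Matrix (Fin D) (Fin D) ℝ),
        ContDiff ℝ ∞ F ∧ IsTrajectory F tS tE y ∧ y tE = yE ∧
        IsCostate F L tS tE y σ ∧ IsTruncatedHessian F L tS tE y k ∧
        ¬ CurvatureTermVanishes F tS tE y σ ∧
        k tS ≠ hess (lossFrom F L tS tE) (y tS)) :=
  mainTheorem1_general D ENat.LEInfty.out
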